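/- **Setting.** Let $\mathcal G$ be a weakly connected digraph on $\{1,\dots,n\}$ with weighted adjacency matrix $\mathcal W\ge 0$ (entrywise; $w_{ij}>0$ is an edge from $j$ to $i$) and Laplacian $\mathcal L=\mathrm{diag}(\mathcal W\mathbf 1)-\mathcal W$. Let $F\in\mathbb R^{n\times p}$, $H\in\mathbb R^{q\times n}$, and let $\Sigma$ be the network system $\dot x=-\mathcal Lx+Fu$, $y=Hx$. A leading strongly connected component (LSCC) is a strongly connected component that no edge enters from outside. Let $M$ be a positive diagonal matrix such that $L=M\mathcal L$ is the Laplacian of a generalized balanced digraph, i.e. in the digraph with adjacency matrix $M\mathcal W$ one has, for each LSCC $S$ and each $i\in S$, that the weights of the edges inside $S$ entering $i$ and of those leaving $i$ have the same sum. Vertices $i,j$ are clusterable if $e_i-e_j\in\ker(L)^\perp\cap\ker(L^T)^\perp$. Let $\{\mathcal C_1,\dots,\mathcal C_r\}$ be a partition of the vertices into nonempty cells such that any two vertices of one cell are clusterable, with characteristic matrix $\Pi\in\{0,1\}^{n\times r}$ ($\Pi_{ik}=1$ iff $i\in\mathcal C_k$). Let $N$ be a diagonal matrix such that $\Pi^TN\Pi$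 is invertible, such that on each LSCC $S$ the diagonal of $N$ is a multiple of a positive vector $\nu_S$ with $\mathcal L_S^T\nu_S=0$ ($\mathcal L_S$ the diagonal block of $\mathcal L$ belonging to $S$), and such that $N_{ii}N_{jj}>0$ whenever $i,j$ lie in the same cell (for instance, all diagonal entries of $N$ positive). Put $\Pi^\dagger=(\Pi^TN\Pi)^{-1}\Pi^TN$, $\hat{\mathcal L}=\Pi^\dagger\mathcal L\Pi$, $\hat F=\Pi^\dagger F$, $\hat H=H\Pi$, and let $\hat\Sigma$ be the reduced network system $\dot z=-\hat{\mathcal L}z+\hat Fu$, $\hat y=\hat Hz$. A system $\dot x=Ax+Bu$ is semistable if every solution of $\dot x=Ax$ converges as $t\to\infty$; its pseudo controllability Gramian is $$\int_0^\infty(e^{A\tau}-\mathcal J_A)BB^T(e^{A^T\tau}-\mathcal J_A^T)\,d\tau,\qquad \mathcal J_A=\lim_{\tau\to\infty}e^{A\tau}.$$ The $\mathcal H_2$ norm of the difference of the two systems is the $L_2$ norm of the difference of their impulse responses: $$\|\Sigma-\hat\Sigma\|_{\mathcal H_2}^2=\int_0^\infty\mathrm{tr}\left[g(t)^Tg(t)\right]dt,\qquad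 g(t)=He^{-\mathcal Lt}F-\hat He^{-\hat{\mathcal L}t}\hat F.$$ **Theorem.** Both $\Sigma$ and $\hat\Sigma$ are semistable, their pseudo controllability Gramians $\mathcal P_o$ and $\mathcal P_r$ are well defined (the limits exist and the integrals converge absolutely), and $\|\Sigma-\hat\Sigma\|_{\mathcal H_2}<\infty$. With $\mathcal J=\lim_{\tau\to\infty}e^{-\mathcal L\tau}$, the Sylvester equation $$\hat{\mathcal L}\tilde{\mathcal P}_x+\tilde{\mathcal P}_x\mathcal L^T-\Pi^\dagger(I-\mathcal J)FF^T(I-\mathcal J^T)=0$$ has a solution $\tilde{\mathcal P}_x\in\mathbb R^{r\times n}$, and for every solution $\tilde{\mathcal P}_x$, with $\mathcal P_x=\tilde{\mathcal P}_x-\Pi^\dagger\mathcal J\Pi\tilde{\mathcal P}_x\mathcal J^T$, $$\|\Sigma-\hat\Sigma\|_{\mathcal H_2}^2=\mathrm{tr}\left[H\left(\mathcal P_o+\Pi\mathcal P_r\Pi^T-2\Pi\mathcal P_x\right)H^T\right].$$ -/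

import Mathlib

open Filter Topology MeasureTheory Matrix

noncomputable section

namespace NetRed

/-! ### Linear time-invariant systems `x' = A x + B u`, `y = C x` -/

/-- Every trajectory of the unforced system `x' = A x` converges as `t → ∞`. -/
def Semistable {n : ℕ} (A : Matrix (Fin n) (Fin n) ℝ) : Prop :=
  ∀ x : ℝ → Fin n → ℝ, (∀ t : ℝ, HasDerivAt x (A *ᵥ x t) t) →
    ∃ l : Fin n → ℝ, Tendsto x atTop (𝓝 l)

/-- The matrix `lim_{t → ∞} e^{tA}`. -/
def limExp {n : ℕ} (A : Matrix (Fin n) (Fin n) ℝ) : Matrix (Fin n) (Fin n) ℝ :=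
  limUnder atTop (fun t : ℝ => NormedSpace.exp (t • A))

/-- `(e^{tA} - J) B Bᵀ (e^{tAᵀ} - Jᵀ)` with `J = lim_{t → ∞} e^{tA}`. -/
def gramianIntegrand {n p : ℕ} (A : Matrix (Fin n) (Fin n) ℝ) (B : Matrix (Fin n) (Fin p) ℝ)
    (t : ℝ) : Matrix (Fin n) (Fin n) ℝ :=
  (NormedSpace.exp (t • A) - limExp A) * B * Bᵀ * (NormedSpace.exp (t • Aᵀ) - (limExp A)ᵀ)

/-- The pseudo controllability Gramian (the matrix integral is taken entrywise). -/
def pseudoControllabilityGramian {n p : ℕ} (A : Matrix (Fin n) (Fin n) ℝ)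
    (B : Matrix (Fin n) (Fin p) ℝ) : Matrix (Fin n) (Fin n) ℝ :=
  Matrix.of fun i j => ∫ t in Set.Ioi (0 : ℝ), gramianIntegrand A B t i j

/-- The pseudo controllability Gramian is well defined: the limit of `e^{tA}` exists and
the defining integral converges absolutely. -/
def GramianWellDefined {n p : ℕ} (A : Matrix (Fin n) (Fin n) ℝ)
    (B : Matrix (Fin n) (Fin p) ℝ) : Prop :=
  Tendsto (fun t : ℝ => NormedSpace.exp (t • A)) atTop (𝓝 (limExp A)) ∧
    ∀ i j, IntegrableOn (fun t => gramianIntegrand A B t i j) (Set.Ioi (0 : ℝ))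

/-- The impulse response `C e^{tA} B`. -/
def impulseResponse {n p q : ℕ} (A : Matrix (Fin n) (Fin n) ℝ) (B : Matrix (Fin n) (Fin p) ℝ)
    (C : Matrix (Fin q) (Fin n) ℝ) (t : ℝ) : Matrix (Fin q) (Fin p) ℝ :=
  C * NormedSpace.exp (t • A) * B

/-- The `H₂` norm, in `[0, ∞]`, of the system with impulse response `g`: the square root of
`∫₀^∞ tr (g(t)ᵀ g(t)) dt`. -/
def h2Norm {p q : ℕ} (g : ℝ → Matrix (Fin q) (Fin p) ℝ) : ENNReal :=
  (∫⁻ t in Set.Ioi (0 : ℝ), ENNReal.ofReal (((g t)ᵀ * g t).trace)) ^ (1 / 2 : ℝ)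

/-! ### Weighted digraphs -/

/-- The Laplacian matrix `diag(W 𝟙) - W`. -/
def laplacian {n : ℕ} (W : Matrix (Fin n) (Fin n) ℝ) : Matrix (Fin n) (Fin n) ℝ :=
  Matrix.diagonal (fun i => ∑ j, W i j) - W

/-- Vertex `j` reaches vertex `i` along a directed path (possibly of length zero).
A positive entry `W b a` is an edge along which information flows from `a` to `b`. -/
def Reaches {n : ℕ} (W : Matrix (Fin n) (Fin n) ℝ) (j i : Fin n) : Prop :=
  Relation.ReflTransGen (fun a b => 0 < W b a) j i

/-- There is an undirected path between any two vertices. -/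
def WeaklyConnected {n : ℕ} (W : Matrix (Fin n) (Fin n) ℝ) : Prop :=
  ∀ i j, Relation.ReflTransGen (fun a b => 0 < W a b ∨ 0 < W b a) i j

/-- The strongly connected component of a vertex. -/
def scc {n : ℕ} (W : Matrix (Fin n) (Fin n) ℝ) (i : Fin n) : Set (Fin n) :=
  {j | Reaches W i j ∧ Reaches W j i}

/-- `S` is a leading strongly connected component: a strongly connected component that no
edge enters from outside. -/
def IsLSCC {n : ℕ} (W : Matrix (Fin n) (Fin n) ℝ) (S : Set (Fin n)) : Prop :=
  (∃ i, S = scc W i) ∧ ∀ i ∈ S, ∀ j ∉ S, ¬ 0 < W i j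

open Classical in
/-- A weakly connected digraph each of whose leading strongly connected components is balanced. -/
def GeneralizedBalanced {n : ℕ} (W : Matrix (Fin n) (Fin n) ℝ) : Prop :=
  WeaklyConnected W ∧ ∀ S : Set (Fin n), IsLSCC W S → ∀ i ∈ S,
    (∑ j, if j ∈ S then W i j else 0) = ∑ j, if j ∈ S then W j i else 0

/-- `M = diag(m)` is positive and `M ℒ`, the Laplacian of the digraph with adjacency matrix
`M W`, is that of a generalized balanced digraph. -/
def IsBalancing {n : ℕ} (W : Matrix (Fin n) (Fin n) ℝ) (m : Fin n → ℝ) : Prop :=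
  (∀ i, 0 < m i) ∧ GeneralizedBalanced (Matrix.diagonal m * W)

/-- `e_i - e_j` is orthogonal to the kernels of `L = M ℒ` and of `Lᵀ`, where `M = diag(m)`. -/
def Clusterable {n : ℕ} (W : Matrix (Fin n) (Fin n) ℝ) (m : Fin n → ℝ) (i j : Fin n) : Prop :=
  (∀ x : Fin n → ℝ, (Matrix.diagonal m * laplacian W) *ᵥ x = 0 →
    (Pi.single i 1 - Pi.single j 1) ⬝ᵥ x = 0) ∧
  (∀ x : Fin n → ℝ, (Matrix.diagonal m * laplacian W)ᵀ *ᵥ x = 0 →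
    (Pi.single i 1 - Pi.single j 1) ⬝ᵥ x = 0)

/-! ### Reduction by graph clustering

A clustering of `Fin n` into `r` nonempty cells is a surjection `c : Fin n → Fin r`. -/

/-- Any two vertices of one cell are clusterable. -/
def ProperClustering {n r : ℕ} (W : Matrix (Fin n) (Fin n) ℝ) (m : Fin n → ℝ)
    (c : Fin n → Fin r) : Prop :=
  ∀ i j, c i = c j → Clusterable W m i j

/-- The characteristic matrix `Π` of a clustering. -/
def charMatrix {n r : ℕ} (c : Fin n → Fin r) : Matrix (Fin n) (Fin r) ℝ :=
  Matrix.of fun i k => if c i = k then 1 else 0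

/-- The left projection `Π† = (Πᵀ N Π)⁻¹ Πᵀ N` with `N = diag(d)`. -/
def leftProj {n r : ℕ} (c : Fin n → Fin r) (d : Fin n → ℝ) : Matrix (Fin r) (Fin n) ℝ :=
  ((charMatrix c)ᵀ * Matrix.diagonal d * charMatrix c)⁻¹ * (charMatrix c)ᵀ * Matrix.diagonal d

open Classical in
/-- `N = diag(d)` is admissible: `Πᵀ N Π` is invertible and, on each leading strongly connected
component `S`, the diagonal of `N` is a multiple of a positive left null vector `ν` of the
diagonal block of the Laplacian belonging to `S`. -/
def Admissible {n r : ℕ} (W : Matrix (Fin n) (Fin n) ℝ) (c : Fin n → Fin r)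
    (d : Fin n → ℝ) : Prop :=
  IsUnit ((charMatrix c)ᵀ * Matrix.diagonal d * charMatrix c).det ∧
    ∀ S : Set (Fin n), IsLSCC W S → ∃ ν : Fin n → ℝ,
      (∀ i ∈ S, 0 < ν i) ∧ (∀ j ∈ S, (∑ i, if i ∈ S then laplacian W i j * ν i else 0) = 0) ∧
      ∃ a : ℝ, ∀ i ∈ S, d i = a * ν i

/-- The reduced Laplacian `Π† ℒ Π`. -/
def reducedLaplacian {n r : ℕ} (W : Matrix (Fin n) (Fin n) ℝ) (c : Fin n → Fin r)
    (d : Fin n → ℝ) : Matrix (Fin r) (Fin r) ℝ :=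
  leftProj c d * laplacian W * charMatrix c

/-- `‖Σ - Σ̂‖` in the `H₂` norm, for the network `Σ` with matrices `(-ℒ, F, H)` and the reduced
network `Σ̂` with matrices `(-Π† ℒ Π, Π† F, H Π)`. -/
def reductionError {n r p q : ℕ} (W : Matrix (Fin n) (Fin n) ℝ) (F : Matrix (Fin n) (Fin p) ℝ)
    (H : Matrix (Fin q) (Fin n) ℝ) (c : Fin n → Fin r) (d : Fin n → ℝ) : ENNReal :=
  h2Norm fun t => impulseResponse (-laplacian W) F H t -
    impulseResponse (-reducedLaplacian W c d) (leftProj c d * F) (H * charMatrix c) t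

/-- `X` solves `ℒ̂ X + X ℒᵀ - Π† (I - J) F Fᵀ (I - Jᵀ) = 0`, where `ℒ̂ = Π† ℒ Π` and
`J = lim_{t → ∞} e^{-tℒ}`. -/
def SolvesSylvester {n r p : ℕ} (W : Matrix (Fin n) (Fin n) ℝ) (F : Matrix (Fin n) (Fin p) ℝ)
    (c : Fin n → Fin r) (d : Fin n → ℝ) (X : Matrix (Fin r) (Fin n) ℝ) : Prop :=
  reducedLaplacian W c d * X + X * (laplacian W)ᵀ -
    leftProj c d * (1 - limExp (-laplacian W)) * F * Fᵀ * (1 - (limExp (-laplacian W))ᵀ) = 0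

/-- `P_x = X - Π† J Π X Jᵀ`. -/
def crossGramian {n r : ℕ} (W : Matrix (Fin n) (Fin n) ℝ) (c : Fin n → Fin r) (d : Fin n → ℝ)
    (X : Matrix (Fin r) (Fin n) ℝ) : Matrix (Fin r) (Fin n) ℝ :=
  X - leftProj c d * limExp (-laplacian W) * charMatrix c * X * (limExp (-laplacian W))ᵀ

end NetRed

end

/-!
Since every weight `d i / ∑ d` within a cell is positive, the rows of `Π†` are convex weights, and
the reduced Laplacian `Π† ℒ Π` is again the Laplacian of a digraph with nonnegative weights
(`NetRed.IsLaplacian.reduced`). Everything that concerns a single system is therefore proved once,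
for an arbitrary Laplacian `L`. By the maximum principle `ker L` meets `range L` trivially, so the
projection `J` onto `ker L` along `range L` exists (`NetRed.IsLaplacian.exists_isKernelProj`). For
small `h` the powers of `1 - h L - J` decay geometrically by Gershgorin's theorem and Gelfand's
formula, whence `e^{-tL} → J` exponentially fast (`NetRed.IsLaplacian.expDecay`). This gives
semistability and absolutely convergent Gramians.

The clustering hypotheses serve to show `Π Π† J = J` and `J Π Π† = J`. The first holds because
vectors in `ker ℒ` are constant on the cells. For the second, a left null vector `η` of `ℒ` has to
be proportional to `d` on each cell (`NetRed.exists_eq_mul_of_vecMul_eq_zero`): left null vectors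
live on the leading strongly connected components, clusterability makes `η / m` constant on each
cell and keeps a cell that meets such a component inside it, and on the component `m` and `d` are
both multiples of its essentially unique positive left null vector. The two identities and the
maximum principle show that `Π† J Π` is the steady-state projection of the reduced system
(`NetRed.IsKernelProj.reduced`).

So the steady states of the two impulse responses cancel, only exponentially decaying transients
remain, and expanding the square gives the two Gramians and a cross integral
(`NetRed.h2Norm_impulseResponse_sub`). Integrating the derivative of `e^{-tℒ̂} X e^{-tℒᵀ}`
identifies that integral with the cross Gramian of any solution `X` of the Sylvester equation, and
shows that it is itself a solution (`NetRed.entryIntegral_cross`).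
-/

noncomputable section

namespace NetRed

/-! ### The projection onto the kernel of a matrix along its range -/

/-- `J` is the projection onto `ker L` along `range L` (it exists only if the eigenvalue `0` of
`L` is semisimple). The two factorizations of `1 - J` say that `ker J = range L` and, together
with `J * L = 0`, that `J` fixes `ker L`. -/
structure IsKernelProj {n : ℕ} (L J : Matrix (Fin n) (Fin n) ℝ) : Prop where
  mul_proj : L * J = 0
  proj_mul : J * L = 0
  exists_mul_left : ∃ Y, 1 - J = L * Y
  exists_mul_right : ∃ Y, 1 - J = Y * L

section KernelProj

variable {n : ℕ} {L J : Matrix (Fin n) (Fin n) ℝ}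

theorem IsKernelProj.proj_mul_self (h : IsKernelProj L J) : J * J = J := by
  obtain ⟨Y, hY⟩ := h.exists_mul_left
  have h1 : J * (1 - J) = 0 := by rw [hY, ← Matrix.mul_assoc, h.proj_mul, Matrix.zero_mul]
  rw [Matrix.mul_sub, Matrix.mul_one, sub_eq_zero] at h1
  exact h1.symm

theorem IsKernelProj.exists_mulVec_eq (h : IsKernelProj L J) {x : Fin n → ℝ}
    (hx : J *ᵥ x = 0) : ∃ u, x = L *ᵥ u := by
  obtain ⟨Y, hY⟩ := h.exists_mul_left
  refine ⟨Y *ᵥ x, ?_⟩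
  rw [Matrix.mulVec_mulVec, ← hY, Matrix.sub_mulVec, Matrix.one_mulVec, hx, sub_zero]

/-- If `ker L² = ker L`, then `ker Lᵏ ⊆ ker L` for every `k`, here for the columns of `Z`. -/
theorem mul_eq_zero_of_pow_mul_eq_zero
    (h : ∀ x : Fin n → ℝ, L *ᵥ (L *ᵥ x) = 0 → L *ᵥ x = 0) (Z : Matrix (Fin n) (Fin n) ℝ)
    (k : ℕ) (hZ : L ^ k * Z = 0) : L * Z = 0 := by
  induction k with
  | zero =>
    rw [pow_zero, Matrix.one_mul] at hZ
    rw [hZ, Matrix.mul_zero]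
  | succ k ih =>
    cases k with
    | zero => simpa using hZ
    | succ k =>
      refine ih (Matrix.ext_of_mulVec_single fun i => ?_)
      have h1 : L *ᵥ (L *ᵥ ((L ^ k * Z) *ᵥ Pi.single i 1)) = 0 := by
        rw [Matrix.mulVec_mulVec, Matrix.mulVec_mulVec, ← Matrix.mul_assoc,
          ← pow_two, ← pow_add, Nat.add_comm 2 k, hZ, Matrix.zero_mulVec]
      have h2 := h _ h1
      rw [Matrix.mulVec_mulVec, ← Matrix.mul_assoc, ← pow_succ'] at h2
      rw [h2, Matrix.zero_mulVec]

/-- If `ker L² = ker L`, split off the power of `X` from the characteristic polynomial of `L`: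
the remaining factor, normalized to have constant term `1` and evaluated at `L`, is the
projection onto `ker L` along `range L`. -/
theorem exists_isKernelProj (h : ∀ x : Fin n → ℝ, L *ᵥ (L *ᵥ x) = 0 → L *ᵥ x = 0) :
    ∃ J, IsKernelProj L J := by
  obtain ⟨q, hq, hdvd⟩ := Polynomial.exists_eq_pow_rootMultiplicity_mul_and_not_dvd L.charpoly
    (Matrix.charpoly_monic L).ne_zero 0
  rw [Polynomial.C_0, sub_zero] at hq hdvd
  have hq0 : q.coeff 0 ≠ 0 := fun h0 => hdvd (Polynomial.X_dvd_iff.2 h0)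
  -- `Q = q(L)` and `Y = (q(L) - q(0)) / L`, so that `1 - Q / q(0)` is a multiple of `L`
  set Q := Polynomial.aeval L q with hQ
  set Y := Polynomial.aeval L q.divX with hY
  have hcomm : L * Y = Y * L := by
    simpa only [map_mul, Polynomial.aeval_X] using
      congrArg (Polynomial.aeval L) (mul_comm Polynomial.X q.divX)
  have hLQ : L * Q = 0 := by
    refine mul_eq_zero_of_pow_mul_eq_zero h _ (L.charpoly.rootMultiplicity 0) ?_
    have h1 := Matrix.aeval_self_charpoly L
    rwa [hq, map_mul, map_pow, Polynomial.aeval_X] at h1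
  have hQY : Q = Y * L + q.coeff 0 • 1 := by
    conv_lhs => rw [hQ, ← Polynomial.divX_mul_X_add q]
    rw [map_add, map_mul, Polynomial.aeval_X, Polynomial.aeval_C, Algebra.algebraMap_eq_smul_one]
  have hQL : Q * L = 0 := by
    rw [← hLQ, hQY, Matrix.add_mul, Matrix.mul_add]
    rw [← Matrix.mul_assoc, hcomm, Matrix.smul_mul, Matrix.mul_smul, Matrix.one_mul,
      Matrix.mul_one]
  refine ⟨(q.coeff 0)⁻¹ • Q, ?_, ?_, ⟨-((q.coeff 0)⁻¹ • Y), ?_⟩, ⟨-((q.coeff 0)⁻¹ • Y), ?_⟩⟩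
  · rw [Matrix.mul_smul, hLQ, smul_zero]
  · rw [Matrix.smul_mul, hQL, smul_zero]
  · rw [hQY, smul_add, smul_smul, inv_mul_cancel₀ hq0, Matrix.mul_neg, Matrix.mul_smul, hcomm]
    simp
  · rw [hQY, smul_add, smul_smul, inv_mul_cancel₀ hq0, Matrix.neg_mul, Matrix.smul_mul]
    simp

end KernelProj

/-! ### Laplacians and the maximum principle -/

/-- `L` is the Laplacian of some digraph with nonnegative weights: its off-diagonal entries are
nonpositive and its rows sum to zero. -/
structure IsLaplacian {n : ℕ} (L : Matrix (Fin n) (Fin n) ℝ) : Prop where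
  offDiag_nonpos : ∀ i j, i ≠ j → L i j ≤ 0
  row_sum : ∀ i, ∑ j, L i j = 0

section Laplacian

variable {n : ℕ} {L : Matrix (Fin n) (Fin n) ℝ}

theorem IsLaplacian.mulVec_apply (hL : IsLaplacian L) (x : Fin n → ℝ) (i : Fin n) :
    (L *ᵥ x) i = ∑ j, L i j * (x j - x i) := by
  simp only [mul_sub, Finset.sum_sub_distrib, ← Finset.sum_mul, hL.row_sum, zero_mul, sub_zero]
  rfl

theorem IsLaplacian.term_nonneg (hL : IsLaplacian L) {x : Fin n → ℝ} {i : Fin n}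
    (hi : ∀ k, x k ≤ x i) (j : Fin n) : 0 ≤ L i j * (x j - x i) := by
  by_cases hij : i = j
  · simp [hij]
  · exact mul_nonneg_of_nonpos_of_nonpos (hL.offDiag_nonpos i j hij) (sub_nonpos.2 (hi j))

theorem IsLaplacian.mulVec_nonneg_of_max (hL : IsLaplacian L) {x : Fin n → ℝ} {i : Fin n}
    (hi : ∀ k, x k ≤ x i) : 0 ≤ (L *ᵥ x) i := by
  rw [hL.mulVec_apply]
  exact Finset.sum_nonneg fun j _ => hL.term_nonneg hi j

theorem IsLaplacian.eq_max_of_mulVec_eq_zero (hL : IsLaplacian L) {x : Fin n → ℝ} {i j : Fin n}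
    (hi : ∀ k, x k ≤ x i) (h0 : (L *ᵥ x) i = 0) (hij : L i j ≠ 0) : x j = x i := by
  rw [hL.mulVec_apply, Finset.sum_eq_zero_iff_of_nonneg fun j _ => hL.term_nonneg hi j] at h0
  have := h0 j (Finset.mem_univ j)
  rcases mul_eq_zero.1 this with h | h
  · exact absurd h hij
  · linarith

/-- A vector `x` in the range of `L` with `L x = 0` at its maximum points is nonpositive:
harmonicity says that no edge enters the set where `x` is maximal, and if `x = L u`, then `x` is
nonpositive at a minimum point of `u` within that set. -/
theorem IsLaplacian.nonpos_of_harmonic_at_max (hL : IsLaplacian L) {x u : Fin n → ℝ}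
    (hx : x = L *ᵥ u) (h : ∀ i, (∀ k, x k ≤ x i) → (L *ᵥ x) i = 0) (k : Fin n) : x k ≤ 0 := by
  classical
  obtain ⟨i₀, -, hi₀⟩ := Finset.exists_max_image Finset.univ x ⟨k, Finset.mem_univ k⟩
  replace hi₀ : ∀ k, x k ≤ x i₀ := fun k => hi₀ k (Finset.mem_univ k)
  refine (hi₀ k).trans ?_
  obtain ⟨i, hiA, hi⟩ := Finset.exists_min_image (Finset.univ.filter fun i => x i = x i₀) u
    ⟨i₀, by simp⟩
  simp only [Finset.mem_filter, Finset.mem_univ, true_and] at hiA hi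
  have himax : ∀ k, x k ≤ x i := fun k => hiA ▸ hi₀ k
  rw [← hiA, hx, hL.mulVec_apply]
  refine Finset.sum_nonpos fun j _ => ?_
  by_cases hij : i = j
  · simp [hij]
  by_cases h0 : L i j = 0
  · simp [h0]
  have hj : x j = x i₀ := (hL.eq_max_of_mulVec_eq_zero himax (h i himax) h0).trans hiA
  exact mul_nonpos_of_nonpos_of_nonneg (hL.offDiag_nonpos i j hij) (sub_nonneg.2 (hi j hj))

theorem IsLaplacian.eq_zero_of_harmonic_at_extrema (hL : IsLaplacian L) {x u : Fin n → ℝ}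
    (hx : x = L *ᵥ u) (hmax : ∀ i, (∀ k, x k ≤ x i) → (L *ᵥ x) i = 0)
    (hmin : ∀ i, (∀ k, x i ≤ x k) → (L *ᵥ x) i = 0) : x = 0 := by
  funext k
  refine le_antisymm (hL.nonpos_of_harmonic_at_max hx hmax k) ?_
  have h := hL.nonpos_of_harmonic_at_max (x := -x) (u := -u) (by rw [hx, Matrix.mulVec_neg])
    (fun i hi => by
      rw [Matrix.mulVec_neg, Pi.neg_apply, hmin i fun k => by simpa using hi k, neg_zero]) k
  simpa using h

theorem IsLaplacian.exists_isKernelProj (hL : IsLaplacian L) : ∃ J, IsKernelProj L J :=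
  NetRed.exists_isKernelProj fun x hx =>
    hL.eq_zero_of_harmonic_at_extrema (u := x) rfl (fun i _ => congrFun hx i)
      fun i _ => congrFun hx i

theorem isLaplacian_laplacian {W : Matrix (Fin n) (Fin n) ℝ} (hW : ∀ i j, 0 ≤ W i j) :
    IsLaplacian (laplacian W) where
  offDiag_nonpos i j hij := by simp [laplacian, Matrix.diagonal_apply_ne _ hij, hW i j]
  row_sum i := by simp [laplacian, Matrix.diagonal_apply]

end Laplacian

/-! ### Exponential convergence of `e^{-tL}` -/

section Decay

attribute [local instance] Matrix.linftyOpNormedAddCommGroup Matrix.linftyOpNormedSpace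
  Matrix.linftyOpNormedRing Matrix.linftyOpNormedAlgebra

variable {n : ℕ} {L J : Matrix (Fin n) (Fin n) ℝ}

theorem exists_norm_pow_le_of_spectralRadius_lt_one {A : Type*} [NormedRing A]
    [NormedAlgebra ℂ A] [CompleteSpace A] (a : A) (ha : spectralRadius ℂ a < 1) :
    ∃ C ρ : ℝ, 0 ≤ C ∧ 0 < ρ ∧ ρ < 1 ∧ ∀ k : ℕ, ‖a ^ k‖ ≤ C * ρ ^ k := by
  obtain ⟨ρ, hρ, hρ1⟩ := ENNReal.lt_iff_exists_nnreal_btwn.1 ha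
  have hρ0 : 0 < ρ := by exact_mod_cast (zero_le (a := spectralRadius ℂ a)).trans_lt hρ
  have hO : (fun k : ℕ => a ^ k) =O[atTop] fun k : ℕ => (ρ : ℝ) ^ k := by
    refine Asymptotics.IsBigO.of_bound 1 ?_
    filter_upwards [(spectrum.pow_nnnorm_pow_one_div_tendsto_nhds_spectralRadius a).eventually
      (gt_mem_nhds hρ), eventually_gt_atTop 0] with k hk hk0
    have h1 : (‖a ^ k‖₊ : ENNReal) ≤ (ρ : ENNReal) ^ k := by
      have := ENNReal.rpow_le_rpow hk.le (Nat.cast_nonneg k)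
      rwa [← ENNReal.rpow_mul, one_div, inv_mul_cancel₀ (Nat.cast_ne_zero.2 hk0.ne'),
        ENNReal.rpow_one, ENNReal.rpow_natCast] at this
    have h2 : ‖a ^ k‖₊ ≤ ρ ^ k := by exact_mod_cast h1
    rw [one_mul, Real.norm_of_nonneg (by positivity)]
    exact_mod_cast h2
  obtain ⟨C, hC, hb⟩ := Asymptotics.bound_of_isBigO_nat_atTop hO
  refine ⟨C, ρ, hC.le, by exact_mod_cast hρ0, by exact_mod_cast hρ1, fun k => ?_⟩
  have := hb (x := k) (by positivity)
  rwa [Real.norm_of_nonneg (by positivity)] at this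

theorem norm_map_ofReal (A : Matrix (Fin n) (Fin n) ℝ) :
    ‖A.map (algebraMap ℝ ℂ)‖ = ‖A‖ := by
  simp [Matrix.linfty_opNorm_def]

/-- For a small step `h`, the matrix `1 - h L` is stochastic with positive diagonal, so its
Gershgorin discs touch the unit circle only at `1`; subtracting `J` removes the
eigenvalue `1`. -/
theorem IsLaplacian.norm_lt_one_of_mem_spectrum (hL : IsLaplacian L) (hJ : IsKernelProj L J)
    {h : ℝ} (h0 : 0 < h) (h1 : ∀ i, h * L i i < 1) {μ : ℂ}
    (hμ : μ ∈ spectrum ℂ ((1 - h • L - J).map (algebraMap ℝ ℂ))) : ‖μ‖ < 1 := by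
  set φ := (algebraMap ℝ ℂ).mapMatrix (m := Fin n) with hφ
  by_cases hμ0 : μ = 0
  · simp [hμ0]
  rw [← Matrix.spectrum_toLin', ← Module.End.hasEigenvalue_iff_mem_spectrum] at hμ
  obtain ⟨v, hv⟩ := hμ.exists_hasEigenvector
  have hv0 : v ≠ 0 := hv.2
  have hBv : φ (1 - h • L - J) *ᵥ v = μ • v := by
    exact (Matrix.toLin'_apply _ v).symm.trans hv.apply_eq_smul
  have hJv : φ J *ᵥ v = 0 := by
    have hJB : J * (1 - h • L - J) = 0 := by
      rw [Matrix.mul_sub, Matrix.mul_sub, Matrix.mul_one, Matrix.mul_smul, hJ.proj_mul,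
        hJ.proj_mul_self]
      simp
    have h2 : φ J *ᵥ (μ • v) = 0 := by
      rw [← hBv, Matrix.mulVec_mulVec, ← map_mul, hJB, map_zero, Matrix.zero_mulVec]
    rw [Matrix.mulVec_smul] at h2
    exact (smul_eq_zero.1 h2).resolve_left hμ0
  have hKv : φ (1 - h • L) *ᵥ v = μ • v := by
    rw [← hBv, map_sub φ (1 - h • L) J, Matrix.sub_mulVec, hJv, sub_zero]
  have hKeig : Module.End.HasEigenvalue (Matrix.toLin' (φ (1 - h • L))) μ :=
    Module.End.hasEigenvalue_of_hasEigenvector (x := v)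
      ⟨Module.End.mem_eigenspace_iff.2 ((Matrix.toLin'_apply _ v).trans hKv), hv0⟩
  obtain ⟨i, hi⟩ := eigenvalue_mem_ball hKeig
  set κ : ℝ := 1 - h * L i i with hκ
  have hκ0 : 0 < κ := sub_pos.2 (h1 i)
  have hdiag : φ (1 - h • L) i i = (κ : ℂ) := by
    simp [hφ, hκ]
  have hsum : ∑ j ∈ Finset.univ.erase i, ‖φ (1 - h • L) i j‖ = 1 - κ := by
    have h2 : ∀ j ∈ Finset.univ.erase i, ‖φ (1 - h • L) i j‖ = -h * L i j := by
      intro j hj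
      have hji : i ≠ j := (Finset.ne_of_mem_erase hj).symm
      have h3 : φ (1 - h • L) i j = ((-h * L i j : ℝ) : ℂ) := by
        simp [hφ, Matrix.one_apply_ne hji]
      rw [h3, Complex.norm_real, Real.norm_of_nonneg]
      exact mul_nonneg_of_nonpos_of_nonpos (neg_nonpos.2 h0.le) (hL.offDiag_nonpos i j hji)
    have h4 := Finset.add_sum_erase Finset.univ (fun j => L i j) (Finset.mem_univ i)
    rw [hL.row_sum] at h4
    rw [Finset.sum_congr rfl h2, ← Finset.mul_sum, hκ]
    linear_combination -h * h4
  rw [hdiag, hsum, mem_closedBall_iff_norm] at hi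
  have hle : ‖μ‖ ≤ 1 := by
    calc ‖μ‖ = ‖(μ - κ) + κ‖ := by rw [sub_add_cancel]
      _ ≤ ‖μ - κ‖ + ‖(κ : ℂ)‖ := norm_add_le _ _
      _ ≤ (1 - κ) + κ := by
        rw [Complex.norm_real, Real.norm_of_nonneg hκ0.le]
        gcongr
      _ = 1 := by ring
  refine lt_of_le_of_ne hle fun heq => ?_
  -- the disc of radius `1 - κ` about `κ` meets the unit circle only at `1`
  have hsq : ‖μ - κ‖ ^ 2 ≤ (1 - κ) ^ 2 := by gcongr
  have hμsq : μ.re * μ.re + μ.im * μ.im = 1 := by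
    have := Complex.sq_norm μ
    rw [heq, Complex.normSq_apply] at this
    linarith
  rw [Complex.sq_norm, Complex.normSq_apply] at hsq
  simp only [Complex.sub_re, Complex.ofReal_re, Complex.sub_im, Complex.ofReal_im, sub_zero]
    at hsq
  have hre : 1 ≤ μ.re := by
    by_contra hlt
    nlinarith [mul_pos hκ0 (sub_pos.2 (not_le.1 hlt))]
  have him : μ.im = 0 := by
    have : μ.im * μ.im ≤ 0 := by nlinarith
    exact mul_self_eq_zero.1 (le_antisymm this (mul_self_nonneg _))
  have hμ1 : μ = 1 := by
    refine Complex.ext ?_ (by simpa using him)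
    rw [him] at hμsq
    simp only [Complex.one_re]
    nlinarith
  -- so `v` lies in the kernel of `L`, which `J` fixes, while `J v = 0`
  have hLv : φ L *ᵥ v = 0 := by
    have h5 : φ (h • L) *ᵥ v = 0 := by
      rw [map_sub, map_one, Matrix.sub_mulVec, Matrix.one_mulVec, hμ1, one_smul] at hKv
      simpa using hKv
    have h6 : φ (h • L) = (h : ℂ) • φ L := by
      ext a b; simp [hφ]
    rw [h6, Matrix.smul_mulVec] at h5
    exact (smul_eq_zero.1 h5).resolve_left (Complex.ofReal_ne_zero.2 h0.ne')
  obtain ⟨Y, hY⟩ := hJ.exists_mul_right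
  have h7 : φ (1 - J) *ᵥ v = 0 := by
    rw [hY, map_mul, ← Matrix.mulVec_mulVec, hLv, Matrix.mulVec_zero]
  rw [map_sub, map_one, Matrix.sub_mulVec, Matrix.one_mulVec, hJv, sub_zero] at h7
  exact hv0 h7

/-- Geometric growth of the powers bounds the exponential series termwise. -/
theorem norm_exp_smul_le {A : Type*} [NormedRing A] [NormedAlgebra ℝ A] [CompleteSpace A]
    {a : A} {C ρ : ℝ} (ha : ∀ k : ℕ, ‖a ^ k‖ ≤ C * ρ ^ k) {s : ℝ}
    (hs : 0 ≤ s) : ‖NormedSpace.exp (s • a)‖ ≤ C * Real.exp (s * ρ) := by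
  have h1 := NormedSpace.exp_series_hasSum_exp' (𝕂 := ℝ) (s • a)
  have h2 := (NormedSpace.exp_series_hasSum_exp' (𝕂 := ℝ) (s * ρ)).mul_left C
  rw [← Real.exp_eq_exp_ℝ] at h2
  rw [← h1.tsum_eq]
  refine tsum_of_norm_bounded h2 fun k => ?_
  rw [smul_pow, norm_smul, norm_smul, norm_inv, norm_pow, Real.norm_of_nonneg hs,
    Real.norm_natCast, smul_eq_mul, mul_pow]
  calc ((k.factorial : ℝ))⁻¹ * (s ^ k * ‖a ^ k‖)
      ≤ ((k.factorial : ℝ))⁻¹ * (s ^ k * (C * ρ ^ k)) := by gcongr; exact ha k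
    _ = _ := by ring

theorem exp_mul_of_mul_eq_zero {X Q : Matrix (Fin n) (Fin n) ℝ} (h : X * Q = 0) :
    NormedSpace.exp X * Q = Q := by
  have h2 := (NormedSpace.exp_series_hasSum_exp' (𝕂 := ℝ) X).mul_right Q
  refine h2.unique ?_
  convert hasSum_single 0 ?_ using 1
  · simp
  · intro k hk
    obtain ⟨k, rfl⟩ := Nat.exists_eq_succ_of_ne_zero hk
    rw [Matrix.smul_mul, pow_succ, Matrix.mul_assoc, h, Matrix.mul_zero, smul_zero]

theorem IsKernelProj.exp_mul (hJ : IsKernelProj L J) (t : ℝ) :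
    NormedSpace.exp (t • -L) * J = J :=
  exp_mul_of_mul_eq_zero (by
    rw [Matrix.smul_mul, Matrix.neg_mul, hJ.mul_proj, neg_zero, smul_zero])

/-- The entries of `f` decay exponentially on `[0, ∞)`. -/
def ExpDecay {m k : ℕ} (f : ℝ → Matrix (Fin m) (Fin k) ℝ) : Prop :=
  ∃ C a : ℝ, 0 < a ∧ ∀ t : ℝ, 0 ≤ t → ∀ i j, |f t i j| ≤ C * Real.exp (-a * t)

theorem abs_apply_le_norm (A : Matrix (Fin n) (Fin n) ℝ) (i j : Fin n) : |A i j| ≤ ‖A‖ := by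
  rw [Matrix.linfty_opNorm_def]
  have h1 : ‖A i j‖₊ ≤ ∑ k, ‖A i k‖₊ :=
    Finset.single_le_sum (f := fun k => ‖A i k‖₊) (fun _ _ => zero_le) (Finset.mem_univ j)
  have h2 : ∑ k, ‖A i k‖₊ ≤ Finset.univ.sup fun i => ∑ k, ‖A i k‖₊ :=
    Finset.le_sup (f := fun i => ∑ k, ‖A i k‖₊) (Finset.mem_univ i)
  exact_mod_cast h1.trans h2

/-- With `B = 1 - h L - J` one has `e^{-hsL} - J = e^{-s} e^{sB} (1 - J)`, and the powers of `B`
decay geometrically. -/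
theorem IsLaplacian.expDecay (hL : IsLaplacian L) (hJ : IsKernelProj L J) :
    ExpDecay fun t : ℝ => NormedSpace.exp (t • -L) - J := by
  -- for `n = 0` the spectrum is empty and there is nothing to prove
  rcases isEmpty_or_nonempty (Fin n) with hn | hn
  · exact ⟨0, 1, one_pos, fun t _ i => isEmptyElim i⟩
  obtain ⟨h, h0, h1⟩ : ∃ h : ℝ, 0 < h ∧ ∀ i, h * L i i < 1 := by
    refine ⟨(1 + ∑ i, |L i i|)⁻¹, by positivity, fun i => ?_⟩
    rw [inv_mul_lt_one₀ (by positivity)]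
    have := Finset.single_le_sum (f := fun i => |L i i|) (fun i _ => abs_nonneg _)
      (Finset.mem_univ i)
    linarith [le_abs_self (L i i)]
  set B := 1 - h • L - J with hB
  obtain ⟨C, ρ, hC, hρ0, hρ1, hpow⟩ := exists_norm_pow_le_of_spectralRadius_lt_one
    (B.map (algebraMap ℝ ℂ)) (by
      have := spectrum.spectralRadius_lt_of_forall_lt (B.map (algebraMap ℝ ℂ)) (r := 1)
        fun z hz => hL.norm_lt_one_of_mem_spectrum hJ h0 h1 hz
      simpa using this)
  have hpowB : ∀ k : ℕ, ‖B ^ k‖ ≤ C * ρ ^ k := fun k => by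
    rw [← norm_map_ofReal]
    convert hpow k using 2
    exact map_pow (algebraMap ℝ ℂ).mapMatrix B k
  refine ⟨C * ‖1 - J‖, h⁻¹ * (1 - ρ), mul_pos (inv_pos.2 h0) (sub_pos.2 hρ1), fun t ht i j =>
    (abs_apply_le_norm _ i j).trans ?_⟩
  have hs : 0 ≤ h⁻¹ * t := mul_nonneg (inv_pos.2 h0).le ht
  set s := h⁻¹ * t with hsdef
  have hst : t = s * h := by rw [hsdef]; field_simp
  -- `-tL = s (B + J) - s`, where `B`, `J` and the scalar commute
  have hdec : t • -L = (s • B + s • J) + (-s) • (1 : Matrix (Fin n) (Fin n) ℝ) := by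
    rw [hB, hst, mul_smul]
    simp only [smul_sub, smul_neg, neg_smul]
    abel
  have hBJ : B * J = 0 := by
    rw [hB, Matrix.sub_mul, Matrix.sub_mul, Matrix.one_mul, Matrix.smul_mul, hJ.mul_proj,
      hJ.proj_mul_self]
    simp
  have hJB : J * B = 0 := by
    rw [hB, Matrix.mul_sub, Matrix.mul_sub, Matrix.mul_one, Matrix.mul_smul, hJ.proj_mul,
      hJ.proj_mul_self]
    simp
  have hcomm : Commute (s • B) (s • J) := by
    rw [Commute, SemiconjBy, Matrix.smul_mul, Matrix.mul_smul, Matrix.smul_mul, Matrix.mul_smul,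
      hBJ, hJB]
  have hcomm1 : Commute (s • B + s • J) ((-s) • (1 : Matrix (Fin n) (Fin n) ℝ)) :=
    (Commute.one_right _).smul_right _
  have hkill : NormedSpace.exp (s • J) * (1 - J) = 1 - J :=
    exp_mul_of_mul_eq_zero (by
      rw [Matrix.smul_mul, Matrix.mul_sub, Matrix.mul_one, hJ.proj_mul_self, sub_self, smul_zero])
  have hexp1 : NormedSpace.exp ((-s) • (1 : Matrix (Fin n) (Fin n) ℝ)) = Real.exp (-s) • 1 := by
    rw [← Algebra.algebraMap_eq_smul_one, ← Algebra.algebraMap_eq_smul_one, Real.exp_eq_exp_ℝ]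
    exact (NormedSpace.algebraMap_exp_comm (𝕂 := ℝ) (-s)).symm
  have hfactor : NormedSpace.exp (t • -L) - J =
      Real.exp (-s) • (NormedSpace.exp (s • B) * (1 - J)) := by
    calc NormedSpace.exp (t • -L) - J = NormedSpace.exp (t • -L) * (1 - J) := by
          rw [Matrix.mul_sub, Matrix.mul_one, hJ.exp_mul]
      _ = _ := by
          rw [hdec, Matrix.exp_add_of_commute _ _ hcomm1, Matrix.exp_add_of_commute _ _ hcomm,
            hexp1, Matrix.mul_smul, Matrix.mul_one, Matrix.smul_mul, Matrix.mul_assoc, hkill]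
  rw [hfactor, norm_smul, Real.norm_of_nonneg (Real.exp_pos _).le]
  calc Real.exp (-s) * ‖NormedSpace.exp (s • B) * (1 - J)‖
      ≤ Real.exp (-s) * (C * Real.exp (s * ρ) * ‖1 - J‖) := by
        gcongr
        exact (norm_mul_le _ _).trans
          (mul_le_mul_of_nonneg_right (norm_exp_smul_le hpowB hs) (norm_nonneg _))
    _ = C * ‖1 - J‖ * (Real.exp (-s) * Real.exp (s * ρ)) := by ring
    _ = C * ‖1 - J‖ * Real.exp (-(h⁻¹ * (1 - ρ)) * t) := by
        rw [← Real.exp_add, hsdef]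
        ring_nf

end Decay

/-! ### Entrywise calculus of matrix functions -/

section Entrywise

variable {m k l o : ℕ}

theorem ExpDecay.transpose {f : ℝ → Matrix (Fin m) (Fin k) ℝ} (hf : ExpDecay f) :
    ExpDecay fun t => (f t)ᵀ := by
  obtain ⟨C, a, ha, h⟩ := hf
  exact ⟨C, a, ha, fun t ht i j => h t ht j i⟩

theorem ExpDecay.const_mul {f : ℝ → Matrix (Fin m) (Fin k) ℝ} (hf : ExpDecay f)
    (A : Matrix (Fin l) (Fin m) ℝ) : ExpDecay fun t => A * f t := by
  obtain ⟨C, a, ha, h⟩ := hf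
  refine ⟨(∑ i, ∑ j, |A i j|) * C, a, ha, fun t ht i j => ?_⟩
  have hC : 0 ≤ C * Real.exp (-a * t) ∨ IsEmpty (Fin m) := by
    rcases isEmpty_or_nonempty (Fin m) with hm | ⟨⟨i'⟩⟩
    · exact Or.inr hm
    · exact Or.inl ((abs_nonneg _).trans (h t ht i' j))
  rcases hC with hC | hC
  · dsimp only
    rw [Matrix.mul_apply, mul_assoc]
    calc |∑ x, A i x * f t x j| ≤ ∑ x, |A i x| * (C * Real.exp (-a * t)) := by
          refine (Finset.abs_sum_le_sum_abs _ _).trans (Finset.sum_le_sum fun x _ => ?_)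
          rw [abs_mul]
          exact mul_le_mul_of_nonneg_left (h t ht x j) (abs_nonneg _)
      _ ≤ _ := by
          rw [← Finset.sum_mul]
          refine mul_le_mul_of_nonneg_right ?_ hC
          exact Finset.single_le_sum (f := fun i => ∑ x, |A i x|)
            (fun _ _ => Finset.sum_nonneg fun _ _ => abs_nonneg _) (Finset.mem_univ i)
  · simp [Matrix.mul_apply]

theorem ExpDecay.mul_const {f : ℝ → Matrix (Fin m) (Fin k) ℝ} (hf : ExpDecay f)
    (A : Matrix (Fin k) (Fin l) ℝ) : ExpDecay fun t => f t * A := by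
  simpa only [Matrix.transpose_mul, Matrix.transpose_transpose] using
    (hf.transpose.const_mul Aᵀ).transpose

theorem ExpDecay.mul {f : ℝ → Matrix (Fin m) (Fin k) ℝ} {g : ℝ → Matrix (Fin k) (Fin l) ℝ}
    (hf : ExpDecay f) (hg : ExpDecay g) : ExpDecay fun t => f t * g t := by
  obtain ⟨C, a, ha, h⟩ := hf
  obtain ⟨C', a', ha', h'⟩ := hg
  refine ⟨k * (C * C'), a + a', add_pos ha ha', fun t ht i j => ?_⟩
  dsimp only
  rw [Matrix.mul_apply]
  calc |∑ x, f t i x * g t x j| ≤ ∑ _x : Fin k, C * C' * Real.exp (-(a + a') * t) := by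
        refine (Finset.abs_sum_le_sum_abs _ _).trans (Finset.sum_le_sum fun x _ => ?_)
        rw [abs_mul, neg_add, add_mul, Real.exp_add, mul_mul_mul_comm]
        exact mul_le_mul (h t ht i x) (h' t ht x j) (abs_nonneg _)
          ((abs_nonneg _).trans (h t ht i x))
    _ = _ := by
        rw [Finset.sum_const, Finset.card_univ, Fintype.card_fin, nsmul_eq_mul]
        ring

theorem ExpDecay.tendsto_zero {f : ℝ → Matrix (Fin m) (Fin k) ℝ} (hf : ExpDecay f) :
    Tendsto f atTop (𝓝 0) := by
  obtain ⟨C, a, ha, h⟩ := hf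
  refine tendsto_pi_nhds.2 fun i => tendsto_pi_nhds.2 fun j => ?_
  refine squeeze_zero_norm' (a := fun t => C * Real.exp (-a * t)) ?_ ?_
  · filter_upwards [eventually_ge_atTop 0] with t ht using h t ht i j
  · rw [← mul_zero C]
    refine Tendsto.const_mul C (Real.tendsto_exp_atBot.comp ?_)
    exact tendsto_id.const_mul_atTop_of_neg (neg_lt_zero.2 ha)

theorem ExpDecay.integrableOn {f : ℝ → Matrix (Fin m) (Fin k) ℝ} (hf : ExpDecay f)
    (hc : Continuous f) (i : Fin m) (j : Fin k) :
    IntegrableOn (fun t => f t i j) (Set.Ioi 0) := by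
  obtain ⟨C, a, ha, h⟩ := hf
  refine Integrable.mono' ((integrableOn_exp_mul_Ioi (neg_lt_zero.2 ha) 0).const_mul C)
    (hc.matrix_elem i j).aestronglyMeasurable ?_
  exact (ae_restrict_iff' measurableSet_Ioi).2 (.of_forall fun t ht => h t (le_of_lt ht) i j)

/-- The integral over `(0, ∞)` of a matrix function, taken entrywise. -/
def entryIntegral (f : ℝ → Matrix (Fin m) (Fin k) ℝ) : Matrix (Fin m) (Fin k) ℝ :=
  Matrix.of fun i j => ∫ t in Set.Ioi (0 : ℝ), f t i j

theorem entryIntegral_const_mul {f : ℝ → Matrix (Fin m) (Fin k) ℝ}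
    (hf : ∀ i j, IntegrableOn (fun t => f t i j) (Set.Ioi 0)) (A : Matrix (Fin l) (Fin m) ℝ) :
    entryIntegral (fun t => A * f t) = A * entryIntegral f := by
  ext i j
  simp only [entryIntegral, Matrix.of_apply, Matrix.mul_apply]
  rw [integral_finsetSum _ fun x _ => (hf x j).const_mul (A i x)]
  simp only [integral_const_mul]

theorem integrableOn_const_mul_apply {f : ℝ → Matrix (Fin m) (Fin k) ℝ}
    (hf : ∀ i j, IntegrableOn (fun t => f t i j) (Set.Ioi 0)) (A : Matrix (Fin l) (Fin m) ℝ)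
    (i : Fin l) (j : Fin k) : IntegrableOn (fun t => (A * f t) i j) (Set.Ioi 0) := by
  simp only [Matrix.mul_apply]
  exact integrable_finsetSum _ fun x _ => (hf x j).const_mul (A i x)

theorem integrableOn_mul_const_apply {f : ℝ → Matrix (Fin m) (Fin k) ℝ}
    (hf : ∀ i j, IntegrableOn (fun t => f t i j) (Set.Ioi 0)) (A : Matrix (Fin k) (Fin l) ℝ)
    (i : Fin m) (j : Fin l) : IntegrableOn (fun t => (f t * A) i j) (Set.Ioi 0) := by
  simp only [Matrix.mul_apply]
  exact integrable_finsetSum _ fun x _ => (hf i x).mul_const (A x j)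

theorem entryIntegral_transpose (f : ℝ → Matrix (Fin m) (Fin k) ℝ) :
    entryIntegral (fun t => (f t)ᵀ) = (entryIntegral f)ᵀ := rfl

theorem entryIntegral_mul_const {f : ℝ → Matrix (Fin m) (Fin k) ℝ}
    (hf : ∀ i j, IntegrableOn (fun t => f t i j) (Set.Ioi 0)) (A : Matrix (Fin k) (Fin l) ℝ) :
    entryIntegral (fun t => f t * A) = entryIntegral f * A := by
  have h := entryIntegral_const_mul (f := fun t => (f t)ᵀ) (fun i j => hf j i) Aᵀ
  simp only [← Matrix.transpose_mul, entryIntegral_transpose] at h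
  exact Matrix.transpose_injective h

theorem entryIntegral_add {f g : ℝ → Matrix (Fin m) (Fin k) ℝ}
    (hf : ∀ i j, IntegrableOn (fun t => f t i j) (Set.Ioi 0))
    (hg : ∀ i j, IntegrableOn (fun t => g t i j) (Set.Ioi 0)) :
    entryIntegral (fun t => f t + g t) = entryIntegral f + entryIntegral g := by
  ext i j
  exact integral_add (hf i j) (hg i j)

theorem integral_trace {f : ℝ → Matrix (Fin m) (Fin m) ℝ}
    (hf : ∀ i j, IntegrableOn (fun t => f t i j) (Set.Ioi 0)) :
    ∫ t in Set.Ioi (0 : ℝ), (f t).trace = (entryIntegral f).trace := by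
  simp only [Matrix.trace, Matrix.diag_apply, entryIntegral, Matrix.of_apply]
  exact integral_finsetSum _ fun i _ => hf i i

theorem hasDerivAt_mul_apply {f : ℝ → Matrix (Fin m) (Fin k) ℝ}
    {g : ℝ → Matrix (Fin k) (Fin l) ℝ} {f' : Matrix (Fin m) (Fin k) ℝ}
    {g' : Matrix (Fin k) (Fin l) ℝ} {t : ℝ}
    (hf : ∀ i j, HasDerivAt (fun s => f s i j) (f' i j) t)
    (hg : ∀ i j, HasDerivAt (fun s => g s i j) (g' i j) t) (i : Fin m) (j : Fin l) :
    HasDerivAt (fun s => (f s * g s) i j) ((f' * g t + f t * g') i j) t := by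
  simp only [Matrix.mul_apply, Matrix.add_apply, ← Finset.sum_add_distrib]
  exact HasDerivAt.fun_sum fun x _ => (hf i x).mul (hg x j)

/-- The fundamental theorem of calculus on `(0, ∞)` for matrix functions. -/
theorem entryIntegral_of_hasDerivAt {f f' : ℝ → Matrix (Fin m) (Fin k) ℝ}
    {A : Matrix (Fin m) (Fin k) ℝ}
    (hf : ∀ t i j, HasDerivAt (fun s => f s i j) (f' t i j) t)
    (hf' : ∀ i j, IntegrableOn (fun t => f' t i j) (Set.Ioi 0)) (hA : Tendsto f atTop (𝓝 A)) :
    entryIntegral f' = A - f 0 := by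
  ext i j
  exact integral_Ioi_of_hasDerivAt_of_tendsto' (fun t _ => hf t i j) (hf' i j)
    (tendsto_pi_nhds.1 (tendsto_pi_nhds.1 hA i) j)

end Entrywise

/-! ### Semistability and Gramians -/

section Semistable

variable {n : ℕ}

theorem hasDerivAt_exp_apply (A : Matrix (Fin n) (Fin n) ℝ) (t : ℝ) (i j : Fin n) :
    HasDerivAt (fun s : ℝ => NormedSpace.exp (s • A) i j)
      ((NormedSpace.exp (t • A) * A) i j) t := by
  -- any norm making the matrices a normed algebra will do: the derivative depends only on the
  -- topology
  let _ := Matrix.linftyOpNormedRing (n := Fin n) (α := ℝ)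
  let _ := Matrix.linftyOpNormedAlgebra (R := ℝ) (n := Fin n) (α := ℝ)
  exact hasDerivAt_pi.1 (hasDerivAt_pi.1 (hasDerivAt_exp_smul_const A t) i) j

theorem hasDerivAt_exp_apply' (A : Matrix (Fin n) (Fin n) ℝ) (t : ℝ) (i j : Fin n) :
    HasDerivAt (fun s : ℝ => NormedSpace.exp (s • A) i j)
      ((A * NormedSpace.exp (t • A)) i j) t := by
  let _ := Matrix.linftyOpNormedRing (n := Fin n) (α := ℝ)
  let _ := Matrix.linftyOpNormedAlgebra (R := ℝ) (n := Fin n) (α := ℝ)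
  exact hasDerivAt_pi.1 (hasDerivAt_pi.1 (hasDerivAt_exp_smul_const' A t) i) j

theorem continuous_exp_smul (A : Matrix (Fin n) (Fin n) ℝ) :
    Continuous fun t : ℝ => NormedSpace.exp (t • A) :=
  continuous_matrix fun i j =>
    continuous_iff_continuousAt.2 fun t => (hasDerivAt_exp_apply A t i j).continuousAt

theorem exp_smul_neg_mul_exp_smul (A : Matrix (Fin n) (Fin n) ℝ) (t : ℝ) :
    NormedSpace.exp (t • A) * NormedSpace.exp (t • -A) = 1 := by
  rw [← Matrix.exp_add_of_commute]
  · simp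
  · rw [smul_neg]
    exact (Commute.refl _).neg_right

/-- Trajectories are `x t = e^{tA} x 0`, since `e^{-tA} x t` has derivative zero. -/
theorem eq_exp_mulVec {A : Matrix (Fin n) (Fin n) ℝ} {x : ℝ → Fin n → ℝ}
    (hx : ∀ t : ℝ, HasDerivAt x (A *ᵥ x t) t) (t : ℝ) :
    x t = NormedSpace.exp (t • A) *ᵥ x 0 := by
  have hd : ∀ s i, HasDerivAt (fun s : ℝ => (NormedSpace.exp (s • -A) *ᵥ x s) i) 0 s := by
    intro s i
    have h1 : HasDerivAt (fun s : ℝ => (NormedSpace.exp (s • -A) *ᵥ x s) i)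
        (∑ j, ((NormedSpace.exp (s • -A) * -A) i j * x s j +
          NormedSpace.exp (s • -A) i j * (A *ᵥ x s) j)) s := by
      refine HasDerivAt.fun_sum (u := Finset.univ)
        (A := fun j s => NormedSpace.exp (s • -A) i j * x s j) fun j _ =>
        (hasDerivAt_exp_apply (-A) s i j).mul (hasDerivAt_pi.1 (hx s) j)
    refine h1.congr_deriv ?_
    rw [Finset.sum_add_distrib]
    have h2 : ((NormedSpace.exp (s • -A) * -A) *ᵥ x s + NormedSpace.exp (s • -A) *ᵥ (A *ᵥ x s)) i
        = 0 := by
      rw [Matrix.mulVec_mulVec, ← Matrix.add_mulVec, ← Matrix.mul_add, neg_add_cancel,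
        Matrix.mul_zero, Matrix.zero_mulVec]
      rfl
    exact h2
  have hc : NormedSpace.exp (t • -A) *ᵥ x t = x 0 := by
    funext i
    have := is_const_of_deriv_eq_zero (fun s => (hd s i).differentiableAt)
      (fun s => (hd s i).deriv) t 0
    simpa using this
  rw [← hc, Matrix.mulVec_mulVec, exp_smul_neg_mul_exp_smul, Matrix.one_mulVec]

theorem semistable_of_tendsto {A J : Matrix (Fin n) (Fin n) ℝ}
    (h : Tendsto (fun t : ℝ => NormedSpace.exp (t • A)) atTop (𝓝 J)) : Semistable A := by
  intro x hx
  refine ⟨J *ᵥ x 0, ?_⟩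
  have hc : Continuous fun M : Matrix (Fin n) (Fin n) ℝ => M *ᵥ x 0 :=
    continuous_id.matrix_mulVec continuous_const
  exact ((hc.tendsto J).comp h).congr fun t => (eq_exp_mulVec hx t).symm

variable {L J : Matrix (Fin n) (Fin n) ℝ}

theorem IsLaplacian.tendsto_exp (hL : IsLaplacian L) (hJ : IsKernelProj L J) :
    Tendsto (fun t : ℝ => NormedSpace.exp (t • -L)) atTop (𝓝 J) := by
  simpa using (hL.expDecay hJ).tendsto_zero.add_const J

theorem IsLaplacian.limExp_neg (hL : IsLaplacian L) (hJ : IsKernelProj L J) :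
    limExp (-L) = J :=
  (hL.tendsto_exp hJ).limUnder_eq

theorem continuous_exp_sub (L J : Matrix (Fin n) (Fin n) ℝ) :
    Continuous fun t : ℝ => NormedSpace.exp (t • -L) - J :=
  (continuous_exp_smul (-L)).sub continuous_const

theorem IsLaplacian.gramianIntegrand_eq (hL : IsLaplacian L) (hJ : IsKernelProj L J) {p : ℕ}
    (B : Matrix (Fin n) (Fin p) ℝ) (t : ℝ) :
    gramianIntegrand (-L) B t =
      (NormedSpace.exp (t • -L) - J) * (B * Bᵀ) * (NormedSpace.exp (t • -L) - J)ᵀ := by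
  rw [gramianIntegrand, hL.limExp_neg hJ, ← Matrix.transpose_smul, Matrix.exp_transpose,
    ← Matrix.transpose_sub, ← Matrix.mul_assoc]

theorem IsLaplacian.integrableOn_mul_mul (hL : IsLaplacian L) (hJ : IsKernelProj L J) {r : ℕ}
    {L' J' : Matrix (Fin r) (Fin r) ℝ} (hL' : IsLaplacian L') (hJ' : IsKernelProj L' J')
    (Q : Matrix (Fin r) (Fin n) ℝ) (i : Fin r) (j : Fin n) :
    IntegrableOn (fun t : ℝ => ((NormedSpace.exp (t • -L') - J') * Q *
      (NormedSpace.exp (t • -L) - J)ᵀ) i j) (Set.Ioi 0) :=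
  (((hL'.expDecay hJ').mul_const Q).mul (hL.expDecay hJ).transpose).integrableOn
    (((continuous_exp_sub L' J').matrix_mul continuous_const).matrix_mul
      (continuous_exp_sub L J).matrix_transpose) i j

theorem IsLaplacian.gramianWellDefined (hL : IsLaplacian L) (hJ : IsKernelProj L J) {p : ℕ}
    (B : Matrix (Fin n) (Fin p) ℝ) : GramianWellDefined (-L) B := by
  refine ⟨by rw [hL.limExp_neg hJ]; exact hL.tendsto_exp hJ, fun i j => ?_⟩
  simp only [hL.gramianIntegrand_eq hJ]
  exact hL.integrableOn_mul_mul hJ hL hJ _ i j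

theorem IsLaplacian.pseudoControllabilityGramian_eq (hL : IsLaplacian L)
    (hJ : IsKernelProj L J) {p : ℕ} (B : Matrix (Fin n) (Fin p) ℝ) :
    pseudoControllabilityGramian (-L) B = entryIntegral fun t : ℝ =>
      (NormedSpace.exp (t • -L) - J) * (B * Bᵀ) * (NormedSpace.exp (t • -L) - J)ᵀ := by
  simp only [pseudoControllabilityGramian, hL.gramianIntegrand_eq hJ]
  rfl

end Semistable

/-! ### The Sylvester equation -/

section Sylvester

variable {n r : ℕ} {L J : Matrix (Fin n) (Fin n) ℝ} {L' J' : Matrix (Fin r) (Fin r) ℝ}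
  {Q X : Matrix (Fin r) (Fin n) ℝ}

/-- If `Q` is annihilated by the steady-state projections from both sides, the transients and the
full exponentials act on it in the same way. -/
theorem exp_sub_mul_mul_exp_sub (hJ' : J' * Q = 0) (hJ : Q * Jᵀ = 0) (t : ℝ) :
    (NormedSpace.exp (t • -L') - J') * Q * (NormedSpace.exp (t • -L) - J)ᵀ =
      NormedSpace.exp (t • -L') * Q * (NormedSpace.exp (t • -L))ᵀ := by
  rw [Matrix.sub_mul, hJ', sub_zero, Matrix.transpose_sub, Matrix.mul_sub,
    Matrix.mul_assoc _ Q Jᵀ, hJ, Matrix.mul_zero, sub_zero]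

theorem tendsto_exp_mul_mul_exp (hL : IsLaplacian L) (hJ : IsKernelProj L J)
    (hL' : IsLaplacian L') (hJ' : IsKernelProj L' J') (X : Matrix (Fin r) (Fin n) ℝ) :
    Tendsto (fun t : ℝ => NormedSpace.exp (t • -L') * X * (NormedSpace.exp (t • -L))ᵀ) atTop
      (𝓝 (J' * X * Jᵀ)) := by
  have hc : Continuous fun M : Matrix (Fin r) (Fin r) ℝ × Matrix (Fin n) (Fin n) ℝ =>
      M.1 * X * M.2ᵀ :=
    (continuous_fst.matrix_mul continuous_const).matrix_mul continuous_snd.matrix_transpose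
  have h1 := (hL'.tendsto_exp hJ').prodMk_nhds (hL.tendsto_exp hJ)
  have h2 := (hc.tendsto (J', J)).comp h1
  exact h2

/-- Integrate the derivative of `e^{-tL'} X e^{-tLᵀ}`. -/
theorem entryIntegral_eq_of_sylvester (hL : IsLaplacian L) (hJ : IsKernelProj L J)
    (hL' : IsLaplacian L') (hJ' : IsKernelProj L' J') (hJQ : J' * Q = 0) (hQJ : Q * Jᵀ = 0)
    (hX : L' * X + X * Lᵀ = Q) :
    (entryIntegral fun t : ℝ => (NormedSpace.exp (t • -L') - J') * Q *
      (NormedSpace.exp (t • -L) - J)ᵀ) = X - J' * X * Jᵀ := by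
  have hint := fun i j => (hL.integrableOn_mul_mul hJ hL' hJ' Q i j)
  have h := entryIntegral_of_hasDerivAt
    (f := fun t : ℝ => NormedSpace.exp (t • -L') * X * (NormedSpace.exp (t • -L))ᵀ)
    (f' := fun t : ℝ => (-1 : Matrix (Fin r) (Fin r) ℝ) * ((NormedSpace.exp (t • -L') - J') * Q *
      (NormedSpace.exp (t • -L) - J)ᵀ)) ?_ ?_ (tendsto_exp_mul_mul_exp hL hJ hL' hJ' X)
  · rw [entryIntegral_const_mul hint] at h
    simp only [zero_smul, NormedSpace.exp_zero, Matrix.transpose_one, Matrix.mul_one,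
      Matrix.one_mul, Matrix.neg_mul] at h
    rw [← neg_sub, ← h, neg_neg]
  · intro t i j
    have h1 := hasDerivAt_mul_apply (t := t)
      (hasDerivAt_mul_apply (hasDerivAt_exp_apply (-L') t)
        (g := fun _ => X) (g' := 0) fun i j => hasDerivAt_const t (X i j))
      (g := fun t : ℝ => (NormedSpace.exp (t • -L))ᵀ)
      (g' := (NormedSpace.exp (t • -L) * -L)ᵀ) (fun i j => hasDerivAt_exp_apply (-L) t j i) i j
    refine h1.congr_deriv (congrArg (fun M : Matrix (Fin r) (Fin n) ℝ => M i j) ?_)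
    rw [exp_sub_mul_mul_exp_sub hJQ hQJ, ← hX]
    simp only [Matrix.mul_add, Matrix.add_mul, Matrix.transpose_mul, Matrix.mul_assoc,
      Matrix.transpose_neg, Matrix.neg_mul, Matrix.mul_neg, Matrix.one_mul, Matrix.mul_zero,
      add_zero]
  · intro i j
    simpa using (hint i j).neg

/-- Integrate the derivative of `e^{-tL'} Q e^{-tLᵀ}`. -/
theorem sylvester_entryIntegral (hL : IsLaplacian L) (hJ : IsKernelProj L J)
    (hL' : IsLaplacian L') (hJ' : IsKernelProj L' J') (hJQ : J' * Q = 0) (hQJ : Q * Jᵀ = 0) :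
    L' * (entryIntegral fun t : ℝ => (NormedSpace.exp (t • -L') - J') * Q *
        (NormedSpace.exp (t • -L) - J)ᵀ) +
      (entryIntegral fun t : ℝ => (NormedSpace.exp (t • -L') - J') * Q *
        (NormedSpace.exp (t • -L) - J)ᵀ) * Lᵀ = Q := by
  have hint := fun i j => (hL.integrableOn_mul_mul hJ hL' hJ' Q i j)
  have hdec := ((hL'.expDecay hJ').mul_const Q).mul (hL.expDecay hJ).transpose
  have hcont : Continuous fun t : ℝ => (NormedSpace.exp (t • -L') - J') * Q *
      (NormedSpace.exp (t • -L) - J)ᵀ :=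
    ((continuous_exp_sub L' J').matrix_mul continuous_const).matrix_mul
      (continuous_exp_sub L J).matrix_transpose
  have hint1 := fun i j =>
    (hdec.const_mul (-L')).integrableOn (continuous_const.matrix_mul hcont) i j
  have hint2 := fun i j =>
    (hdec.mul_const (-Lᵀ)).integrableOn (hcont.matrix_mul continuous_const) i j
  have h := entryIntegral_of_hasDerivAt
    (f := fun t : ℝ => NormedSpace.exp (t • -L') * Q * (NormedSpace.exp (t • -L))ᵀ)
    (f' := fun t : ℝ => -L' * ((NormedSpace.exp (t • -L') - J') * Q *
      (NormedSpace.exp (t • -L) - J)ᵀ) + ((NormedSpace.exp (t • -L') - J') * Q *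
      (NormedSpace.exp (t • -L) - J)ᵀ) * -Lᵀ) ?_ (fun i j => (hint1 i j).add (hint2 i j))
      (tendsto_exp_mul_mul_exp hL hJ hL' hJ' Q)
  · rw [entryIntegral_add hint1 hint2, entryIntegral_const_mul hint, entryIntegral_mul_const hint,
      hJQ, Matrix.zero_mul, zero_sub] at h
    simp only [zero_smul, NormedSpace.exp_zero, Matrix.transpose_one, Matrix.mul_one,
      Matrix.one_mul, Matrix.neg_mul, Matrix.mul_neg, ← neg_add] at h
    exact neg_injective h
  · intro t i j
    have h1 := hasDerivAt_mul_apply (t := t)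
      (hasDerivAt_mul_apply (hasDerivAt_exp_apply' (-L') t)
        (g := fun _ => Q) (g' := 0) fun i j => hasDerivAt_const t (Q i j))
      (g := fun t : ℝ => (NormedSpace.exp (t • -L))ᵀ)
      (g' := (-L * NormedSpace.exp (t • -L))ᵀ) (fun i j => hasDerivAt_exp_apply' (-L) t j i) i j
    refine h1.congr_deriv (congrArg (fun M : Matrix (Fin r) (Fin n) ℝ => M i j) ?_)
    rw [exp_sub_mul_mul_exp_sub hJQ hQJ]
    simp only [Matrix.transpose_mul, Matrix.mul_assoc, Matrix.transpose_neg, Matrix.mul_zero,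
      add_zero]

end Sylvester

/-! ### The `H₂` error of a projection-based reduction -/

theorem trace_transpose_mul_self_nonneg {p q : ℕ} (A : Matrix (Fin q) (Fin p) ℝ) :
    0 ≤ (Aᵀ * A).trace := by
  simp only [Matrix.trace, Matrix.diag_apply, Matrix.mul_apply, Matrix.transpose_apply]
  exact Finset.sum_nonneg fun _ _ => Finset.sum_nonneg fun _ _ => mul_self_nonneg _

theorem h2Norm_of_integrableOn {p q : ℕ} {g : ℝ → Matrix (Fin q) (Fin p) ℝ}
    (hg : IntegrableOn (fun t => ((g t)ᵀ * g t).trace) (Set.Ioi 0)) :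
    h2Norm g ≠ ⊤ ∧ (h2Norm g).toReal ^ 2 = ∫ t in Set.Ioi (0 : ℝ), ((g t)ᵀ * g t).trace := by
  have h0 : ∀ t, 0 ≤ ((g t)ᵀ * g t).trace := fun t => trace_transpose_mul_self_nonneg (g t)
  have h1 : h2Norm g =
      ENNReal.ofReal (∫ t in Set.Ioi (0 : ℝ), ((g t)ᵀ * g t).trace) ^ (1 / 2 : ℝ) := by
    rw [h2Norm, ofReal_integral_eq_lintegral_ofReal hg (ae_of_all _ h0)]
  have h2 : 0 ≤ ∫ t in Set.Ioi (0 : ℝ), ((g t)ᵀ * g t).trace := integral_nonneg h0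
  rw [h1]
  refine ⟨ENNReal.rpow_ne_top_of_nonneg (by norm_num) ENNReal.ofReal_ne_top, ?_⟩
  rw [← ENNReal.toReal_rpow, ENNReal.toReal_ofReal h2, ← Real.sqrt_eq_rpow, Real.sq_sqrt h2]

section Reduction

variable {n r p q : ℕ} {L J : Matrix (Fin n) (Fin n) ℝ} {L' J' : Matrix (Fin r) (Fin r) ℝ}
  {R : Matrix (Fin n) (Fin r) ℝ} {S : Matrix (Fin r) (Fin n) ℝ}

/-- If the two steady states match (`J = R J' S`), only the transients contribute to the
difference of the impulse responses, and its energy is the trace of a combination of the two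
Gramians and the cross term. -/
theorem h2Norm_impulseResponse_sub (hL : IsLaplacian L) (hJ : IsKernelProj L J)
    (hL' : IsLaplacian L') (hJ' : IsKernelProj L' J') (hRS : R * J' * S = J)
    (F : Matrix (Fin n) (Fin p) ℝ) (H : Matrix (Fin q) (Fin n) ℝ) :
    h2Norm (fun t => impulseResponse (-L) F H t - impulseResponse (-L') (S * F) (H * R) t) ≠ ⊤ ∧
    (h2Norm fun t => impulseResponse (-L) F H t -
      impulseResponse (-L') (S * F) (H * R) t).toReal ^ 2 =
      (H * (pseudoControllabilityGramian (-L) F +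
        R * pseudoControllabilityGramian (-L') (S * F) * Rᵀ -
        (2 : ℝ) • (R * entryIntegral fun t : ℝ => (NormedSpace.exp (t • -L') - J') *
          (S * F * Fᵀ) * (NormedSpace.exp (t • -L) - J)ᵀ)) * Hᵀ).trace := by
  set D : ℝ → Matrix (Fin n) (Fin n) ℝ := fun t => NormedSpace.exp (t • -L) - J with hD
  set D' : ℝ → Matrix (Fin r) (Fin r) ℝ := fun t => NormedSpace.exp (t • -L') - J' with hD'
  set K : ℝ → Matrix (Fin n) (Fin n) ℝ := fun t => D t * (F * Fᵀ) * (D t)ᵀ with hK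
  set K' : ℝ → Matrix (Fin r) (Fin r) ℝ := fun t => D' t * (S * F * (S * F)ᵀ) * (D' t)ᵀ with hK'
  set M : ℝ → Matrix (Fin r) (Fin n) ℝ := fun t => D' t * (S * F * Fᵀ) * (D t)ᵀ with hM
  have hKi : ∀ i j, IntegrableOn (fun t => K t i j) (Set.Ioi 0) :=
    fun i j => hL.integrableOn_mul_mul hJ hL hJ _ i j
  have hK'i : ∀ i j, IntegrableOn (fun t => K' t i j) (Set.Ioi 0) :=
    fun i j => hL'.integrableOn_mul_mul hJ' hL' hJ' _ i j
  have hMi : ∀ i j, IntegrableOn (fun t => M t i j) (Set.Ioi 0) :=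
    fun i j => hL.integrableOn_mul_mul hJ hL' hJ' _ i j
  have hg : ∀ t, impulseResponse (-L) F H t - impulseResponse (-L') (S * F) (H * R) t =
      H * (D t * F - R * (D' t * (S * F))) := by
    intro t
    have h1 : R * J' * (S * F) = J * F := by rw [← Matrix.mul_assoc, hRS]
    simp only [impulseResponse, hD, hD', Matrix.sub_mul, Matrix.mul_sub]
    rw [← Matrix.mul_assoc R J', h1]
    simp only [Matrix.mul_assoc]
    abel
  have hPo : pseudoControllabilityGramian (-L) F = entryIntegral K :=
    hL.pseudoControllabilityGramian_eq hJ F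
  have hPr : pseudoControllabilityGramian (-L') (S * F) = entryIntegral K' :=
    hL'.pseudoControllabilityGramian_eq hJ' (S * F)
  clear_value D D'
  -- the square of the transient; the two mixed terms are transposes of each other
  have htrace : ∀ t, ((impulseResponse (-L) F H t -
      impulseResponse (-L') (S * F) (H * R) t)ᵀ * (impulseResponse (-L) F H t -
      impulseResponse (-L') (S * F) (H * R) t)).trace =
      (H * K t * Hᵀ).trace + (H * R * K' t * (H * R)ᵀ).trace - 2 * (H * R * M t * Hᵀ).trace := by
    intro t
    have hsymm : (H * D t * F * (H * R * D' t * (S * F))ᵀ).trace =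
        (H * R * M t * Hᵀ).trace := by
      rw [← Matrix.trace_transpose, Matrix.transpose_mul, Matrix.transpose_transpose]
      simp only [hM, Matrix.transpose_mul, Matrix.mul_assoc]
    have hM' : (H * R * D' t * (S * F) * (H * D t * F)ᵀ).trace = (H * R * M t * Hᵀ).trace := by
      simp only [hM, Matrix.transpose_mul, Matrix.mul_assoc]
    have hKt : (H * D t * F * (H * D t * F)ᵀ).trace = (H * K t * Hᵀ).trace := by
      simp only [hK, Matrix.transpose_mul, Matrix.mul_assoc]
    have hKt' : (H * R * D' t * (S * F) * (H * R * D' t * (S * F))ᵀ).trace =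
        (H * R * K' t * (H * R)ᵀ).trace := by
      simp only [hK', Matrix.transpose_mul, Matrix.mul_assoc]
    rw [Matrix.trace_mul_comm, hg]
    have h2 : H * (D t * F - R * (D' t * (S * F))) = H * D t * F - H * R * D' t * (S * F) := by
      simp only [Matrix.mul_sub, Matrix.mul_assoc]
    rw [h2, Matrix.transpose_sub, Matrix.sub_mul, Matrix.mul_sub, Matrix.mul_sub]
    simp only [Matrix.trace_sub]
    rw [hsymm, hM', hKt, hKt']
    ring
  have hsand : ∀ {a b : ℕ} {f : ℝ → Matrix (Fin a) (Fin b) ℝ} (A : Matrix (Fin q) (Fin a) ℝ)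
      (B : Matrix (Fin b) (Fin q) ℝ), (∀ i j, IntegrableOn (fun t => f t i j) (Set.Ioi 0)) →
      IntegrableOn (fun t => (A * f t * B).trace) (Set.Ioi 0) ∧
      ∫ t in Set.Ioi (0 : ℝ), (A * f t * B).trace = (A * entryIntegral f * B).trace := by
    intro a b f A B hf
    have h1 := integrableOn_const_mul_apply hf A
    have h2 := integrableOn_mul_const_apply h1 B
    refine ⟨integrable_finsetSum _ fun i _ => h2 i i, ?_⟩
    rw [integral_trace h2, entryIntegral_mul_const h1, entryIntegral_const_mul hf]
  obtain ⟨i1, e1⟩ := hsand H Hᵀ hKi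
  obtain ⟨i2, e2⟩ := hsand (H * R) (H * R)ᵀ hK'i
  obtain ⟨i3, e3⟩ := hsand (H * R) Hᵀ hMi
  obtain ⟨hfin, hval⟩ := h2Norm_of_integrableOn (g := fun t => impulseResponse (-L) F H t -
    impulseResponse (-L') (S * F) (H * R) t) (by
      simp only [htrace]
      exact (i1.add i2).sub (i3.const_mul 2))
  refine ⟨hfin, hval.trans ?_⟩
  simp only [htrace]
  have i12 : IntegrableOn (fun t => (H * K t * Hᵀ).trace + (H * R * K' t * (H * R)ᵀ).trace)
      (Set.Ioi 0) := i1.add i2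
  rw [integral_sub i12 (i3.const_mul 2), integral_add i1 i2, integral_const_mul, e1, e2,
    e3, hPo, hPr]
  simp only [Matrix.mul_add, Matrix.mul_sub, Matrix.add_mul, Matrix.sub_mul, Matrix.trace_add,
    Matrix.trace_sub, Matrix.mul_smul, Matrix.smul_mul, Matrix.trace_smul, smul_eq_mul,
    Matrix.transpose_mul, Matrix.mul_assoc]

/-- The cross term is the cross Gramian obtained from any solution of the Sylvester equation,
and it solves the Sylvester equation itself. -/
theorem entryIntegral_cross (hL : IsLaplacian L) (hJ : IsKernelProj L J)
    (hL' : IsLaplacian L') (hJ' : IsKernelProj L' J') (hSJ : J' * S = S * J)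
    (F : Matrix (Fin n) (Fin p) ℝ) :
    (∀ X : Matrix (Fin r) (Fin n) ℝ, L' * X + X * Lᵀ - S * (1 - J) * F * Fᵀ * (1 - Jᵀ) = 0 →
      (entryIntegral fun t : ℝ => (NormedSpace.exp (t • -L') - J') *
        (S * F * Fᵀ) * (NormedSpace.exp (t • -L) - J)ᵀ) = X - J' * X * Jᵀ) ∧
    ∃ X : Matrix (Fin r) (Fin n) ℝ, L' * X + X * Lᵀ - S * (1 - J) * F * Fᵀ * (1 - Jᵀ) = 0 := by
  set Q := S * (1 - J) * F * Fᵀ * (1 - Jᵀ) with hQ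
  have hJQ : J' * Q = 0 := by
    have h1 : J' * (S * (1 - J)) = 0 := by
      rw [← Matrix.mul_assoc, hSJ, Matrix.mul_assoc, Matrix.mul_sub, Matrix.mul_one,
        hJ.proj_mul_self, sub_self, Matrix.mul_zero]
    rw [hQ, ← Matrix.mul_assoc, ← Matrix.mul_assoc, ← Matrix.mul_assoc, h1]
    simp only [Matrix.zero_mul]
  have hQJ : Q * Jᵀ = 0 := by
    rw [hQ, Matrix.mul_assoc _ (1 - Jᵀ), Matrix.sub_mul, Matrix.one_mul, ← Matrix.transpose_mul,
      hJ.proj_mul_self, sub_self, Matrix.mul_zero]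
  have hint : (fun t : ℝ => (NormedSpace.exp (t • -L') - J') *
        (S * F * Fᵀ) * (NormedSpace.exp (t • -L) - J)ᵀ) = fun t : ℝ =>
        (NormedSpace.exp (t • -L') - J') * Q * (NormedSpace.exp (t • -L) - J)ᵀ := by
    funext t
    have h1 : (NormedSpace.exp (t • -L') - J') * (S * (1 - J)) =
        (NormedSpace.exp (t • -L') - J') * S := by
      rw [Matrix.mul_sub, Matrix.mul_one, Matrix.mul_sub, ← hSJ,
        ← Matrix.mul_assoc _ J', Matrix.sub_mul _ _ J', hJ'.exp_mul, hJ'.proj_mul_self, sub_self,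
        Matrix.zero_mul, sub_zero]
    have h2 : (1 - Jᵀ) * (NormedSpace.exp (t • -L) - J)ᵀ = (NormedSpace.exp (t • -L) - J)ᵀ := by
      rw [← Matrix.transpose_one, ← Matrix.transpose_sub, ← Matrix.transpose_mul,
        Matrix.mul_sub, Matrix.mul_one, Matrix.sub_mul _ _ J, hJ.exp_mul, hJ.proj_mul_self,
        sub_self, sub_zero]
    calc (NormedSpace.exp (t • -L') - J') * (S * F * Fᵀ) * (NormedSpace.exp (t • -L) - J)ᵀ
        = (NormedSpace.exp (t • -L') - J') * S * (F * Fᵀ) * (NormedSpace.exp (t • -L) - J)ᵀ := by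
          simp only [Matrix.mul_assoc]
      _ = (NormedSpace.exp (t • -L') - J') * (S * (1 - J)) * (F * Fᵀ) *
            ((1 - Jᵀ) * (NormedSpace.exp (t • -L) - J)ᵀ) := by rw [h1, h2]
      _ = _ := by simp only [hQ, Matrix.mul_assoc]
  -- `Q` is killed by `J'` from the left and by `Jᵀ` from the right, so the Sylvester lemmas apply
  rw [hint]
  refine ⟨fun X hX => entryIntegral_eq_of_sylvester hL hJ hL' hJ' hJQ hQJ (sub_eq_zero.1 hX),
    _, sub_eq_zero.2 (sylvester_entryIntegral hL hJ hL' hJ' hJQ hQJ)⟩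

end Reduction

/-! ### Left null vectors of a Laplacian -/

section LeftNull

variable {n : ℕ} {W : Matrix (Fin n) (Fin n) ℝ}

theorem vecMul_laplacian_apply (W : Matrix (Fin n) (Fin n) ℝ) (η : Fin n → ℝ) (j : Fin n) :
    (η ᵥ* laplacian W) j = η j * ∑ k, W j k - ∑ i, η i * W i j := by
  rw [laplacian, Matrix.vecMul_sub, Pi.sub_apply, Matrix.vecMul_diagonal]
  rfl

theorem vecMul_laplacian_eq_zero_iff {η : Fin n → ℝ} :
    η ᵥ* laplacian W = 0 ↔ ∀ j, η j * ∑ k, W j k = ∑ i, η i * W i j := by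
  simp only [funext_iff, vecMul_laplacian_apply, sub_eq_zero, Pi.zero_apply]

/-- The triangle inequality gives one inequality in each column, and summing over the columns
shows that all of them are equalities. -/
theorem abs_vecMul_laplacian_eq_zero (hW : ∀ i j, 0 ≤ W i j) {η : Fin n → ℝ}
    (hη : η ᵥ* laplacian W = 0) : (fun i => |η i|) ᵥ* laplacian W = 0 := by
  rw [vecMul_laplacian_eq_zero_iff] at hη ⊢
  have hle : ∀ j ∈ Finset.univ, |η j| * ∑ k, W j k ≤ ∑ i, |η i| * W i j := by
    intro j _
    rw [← abs_of_nonneg (Finset.sum_nonneg fun k _ => hW j k), ← abs_mul, hη j]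
    refine (Finset.abs_sum_le_sum_abs _ _).trans (Finset.sum_le_sum fun i _ => ?_)
    rw [abs_mul, abs_of_nonneg (hW i j)]
  have hsum : ∑ j, |η j| * ∑ k, W j k = ∑ j, ∑ i, |η i| * W i j := by
    rw [Finset.sum_comm]
    simp only [Finset.mul_sum]
  exact fun j => (Finset.sum_eq_sum_iff_of_le hle).1 hsum j (Finset.mem_univ j)

/-- The support of a nonnegative left null vector contains all ancestors of its elements. -/
theorem pos_of_reaches (hW : ∀ i j, 0 ≤ W i j) {η : Fin n → ℝ} (hη0 : ∀ i, 0 ≤ η i)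
    (hη : η ᵥ* laplacian W = 0) {i j : Fin n} (hi : 0 < η i) (h : Reaches W j i) : 0 < η j := by
  rw [vecMul_laplacian_eq_zero_iff] at hη
  induction h using Relation.ReflTransGen.head_induction_on with
  | refl => exact hi
  | @head a b hab _ ih =>
    refine (hη0 a).lt_of_ne' fun h0 => ?_
    have h1 := hη a
    rw [h0, zero_mul, eq_comm,
      Finset.sum_eq_zero_iff_of_nonneg fun i _ => mul_nonneg (hη0 i) (hW i a)] at h1
    exact (mul_pos ih hab).ne' (h1 b (Finset.mem_univ b))

/-- A nonnegative left null vector is a stationary flow; no flow leaves a set `T` that no edge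
enters. -/
theorem mul_eq_zero_of_closed (hW : ∀ i j, 0 ≤ W i j) {η : Fin n → ℝ} (hη0 : ∀ i, 0 ≤ η i)
    (hη : η ᵥ* laplacian W = 0) {T : Finset (Fin n)} (hT : ∀ a ∈ T, ∀ b ∉ T, W a b = 0)
    {a b : Fin n} (ha : a ∈ T) (hb : b ∉ T) : η b * W b a = 0 := by
  rw [vecMul_laplacian_eq_zero_iff] at hη
  have h1 : ∑ a ∈ T, η a * ∑ k, W a k = ∑ a ∈ T, ∑ b ∈ T, η b * W b a := by
    rw [Finset.sum_comm]
    refine Finset.sum_congr rfl fun a ha => ?_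
    rw [Finset.mul_sum]
    exact (Finset.sum_subset (Finset.subset_univ T) fun b _ hb => by
      rw [hT a ha b hb, mul_zero]).symm
  have h2 : ∑ a ∈ T, η a * ∑ k, W a k =
      ∑ a ∈ T, ∑ b ∈ T, η b * W b a + ∑ a ∈ T, ∑ b ∈ Tᶜ, η b * W b a := by
    rw [← Finset.sum_add_distrib]
    exact Finset.sum_congr rfl fun a _ => by rw [hη a, Finset.sum_add_sum_compl]
  have h0 : ∀ i j, 0 ≤ η i * W i j := fun i j => mul_nonneg (hη0 i) (hW i j)
  have h3 : ∑ a ∈ T, ∑ b ∈ Tᶜ, η b * W b a = 0 := by linarith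
  rw [Finset.sum_eq_zero_iff_of_nonneg fun a _ => Finset.sum_nonneg fun b _ => h0 b a] at h3
  have h4 := h3 a ha
  rw [Finset.sum_eq_zero_iff_of_nonneg fun b _ => h0 b a] at h4
  exact h4 b (Finset.mem_compl.2 hb)

/-- Left null vectors of a Laplacian live on leading strongly connected components. -/
theorem isLSCC_scc_of_vecMul_eq_zero (hW : ∀ i j, 0 ≤ W i j) {η : Fin n → ℝ}
    (hη : η ᵥ* laplacian W = 0) {j : Fin n} (hj : η j ≠ 0) : IsLSCC W (scc W j) := by
  classical
  have habs := abs_vecMul_laplacian_eq_zero hW hη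
  have habs0 : ∀ i, 0 ≤ |η i| := fun i => abs_nonneg _
  have hback : ∀ k, Reaches W k j → Reaches W j k := by
    intro k hk
    by_contra hjk
    -- a path from `k` to `j` leaves the set of ancestors of `k` along an edge that carries flow
    have key : ∀ a, Reaches W a j → Reaches W a k → False := by
      intro a ha
      induction ha using Relation.ReflTransGen.head_induction_on with
      | refl => exact hjk
      | @head a b hab hbj ih =>
        intro hak
        by_cases hbk : Reaches W b k
        · exact ih hbk
        have hz := mul_eq_zero_of_closed hW habs0 habs
          (T := Finset.univ.filter fun a => Reaches W a k) (a := a) (b := b)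
          (fun x hx y hy => by
            simp only [Finset.mem_filter, Finset.mem_univ, true_and] at hx hy
            by_contra hxy
            exact hy (Relation.ReflTransGen.head ((hW x y).lt_of_ne' hxy) hx))
          (by simpa using hak) (by simpa using hbk)
        exact (mul_pos (pos_of_reaches hW habs0 habs (abs_pos.2 hj) hbj) hab).ne' hz
    exact key k hk Relation.ReflTransGen.refl
  refine ⟨⟨j, rfl⟩, fun i hi x hx hix => hx ?_⟩
  have hxj : Reaches W x j := Relation.ReflTransGen.head hix hi.2
  exact ⟨hback x hxj, hxj⟩

open Classical in
/-- A left null vector of the diagonal block of a leading strongly connected component extends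
by zero to a left null vector of the whole Laplacian, as no edge enters the component. -/
theorem vecMul_extend_eq_zero {S : Set (Fin n)} (hW : ∀ i j, 0 ≤ W i j) (hS : IsLSCC W S)
    {ν : Fin n → ℝ} (hν : ∀ j ∈ S, (∑ i, if i ∈ S then laplacian W i j * ν i else 0) = 0) :
    (fun i => if i ∈ S then ν i else 0) ᵥ* laplacian W = 0 := by
  funext j
  have h1 : ((fun i => if i ∈ S then ν i else 0) ᵥ* laplacian W) j =
      ∑ i, if i ∈ S then laplacian W i j * ν i else 0 := by
    rw [Matrix.vecMul, dotProduct]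
    refine Finset.sum_congr rfl fun i _ => ?_
    split_ifs
    · exact mul_comm _ _
    · exact zero_mul _
  rw [h1]
  by_cases hj : j ∈ S
  · exact hν j hj
  · refine Finset.sum_eq_zero fun i _ => ?_
    split_ifs with hi
    · have hij : i ≠ j := fun h => hj (h ▸ hi)
      have h2 : W i j = 0 := le_antisymm (not_lt.1 (hS.2 i hi j hj)) (hW i j)
      rw [laplacian, Matrix.sub_apply, Matrix.diagonal_apply_ne _ hij, h2, sub_zero, zero_mul]
    · rfl

open Classical in
/-- On a leading strongly connected component the positive left null vector of the diagonal block
is unique up to a factor: subtract the largest admissible multiple of one such vector from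
another; the difference vanishes somewhere, hence on all descendants. -/
theorem exists_eq_mul_of_leftNull {S : Set (Fin n)} (hW : ∀ i j, 0 ≤ W i j) (hS : IsLSCC W S)
    {ν μ : Fin n → ℝ} (hμ0 : ∀ i ∈ S, 0 < μ i)
    (hν : ∀ j ∈ S, (∑ i, if i ∈ S then laplacian W i j * ν i else 0) = 0)
    (hμ : ∀ j ∈ S, (∑ i, if i ∈ S then laplacian W i j * μ i else 0) = 0) :
    ∃ ρ : ℝ, ∀ i ∈ S, ν i = ρ * μ i := by
  obtain ⟨j, hj⟩ := hS.1
  obtain ⟨i₀, hi₀, hmin⟩ := Finset.exists_min_image (Finset.univ.filter fun i => i ∈ S)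
    (fun i => ν i / μ i)
    ⟨j, by simp [hj, scc, Reaches, Relation.ReflTransGen.refl]⟩
  simp only [Finset.mem_filter, Finset.mem_univ, true_and] at hi₀ hmin
  set ρ := ν i₀ / μ i₀ with hρ
  set η : Fin n → ℝ := fun i => if i ∈ S then ν i - ρ * μ i else 0 with hη
  have hη0 : ∀ i, 0 ≤ η i := by
    intro i
    simp only [hη]
    split_ifs with hi
    · exact sub_nonneg.2 ((le_div_iff₀ (hμ0 i hi)).1 (hmin i hi))
    · exact le_rfl
  have hnull : η ᵥ* laplacian W = 0 := by
    have h1 : η = (fun i => if i ∈ S then ν i else 0) - ρ • fun i => if i ∈ S then μ i else 0 := by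
      funext i
      simp only [hη, Pi.sub_apply, Pi.smul_apply, smul_eq_mul]
      split_ifs <;> simp
    rw [h1, Matrix.sub_vecMul, Matrix.smul_vecMul, vecMul_extend_eq_zero hW hS hν,
      vecMul_extend_eq_zero hW hS hμ, smul_zero, sub_zero]
  refine ⟨ρ, fun i hi => ?_⟩
  by_contra hne
  have hηi : 0 < η i := by
    refine (hη0 i).lt_of_ne' ?_
    simp only [hη, if_pos hi]
    exact sub_ne_zero.2 hne
  have hreach : Reaches W i₀ i := by
    rw [hj] at hi₀ hi
    exact Relation.ReflTransGen.trans hi₀.2 hi.1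
  have h2 := pos_of_reaches hW hη0 hnull hηi hreach
  simp only [hη, if_pos hi₀, hρ, div_mul_cancel₀ _ (hμ0 i₀ hi₀).ne', sub_self, lt_irrefl] at h2

theorem isLSCC_diagonal_mul_iff {m : Fin n → ℝ} (hm : ∀ i, 0 < m i) {S : Set (Fin n)} :
    IsLSCC (Matrix.diagonal m * W) S ↔ IsLSCC W S := by
  have h : ∀ i j, 0 < (Matrix.diagonal m * W) i j ↔ 0 < W i j := fun i j => by
    rw [Matrix.diagonal_mul, mul_pos_iff_of_pos_left (hm i)]
  simp only [IsLSCC, scc, Reaches, h]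

open Classical in
/-- On a leading strongly connected component, balance of `diag(m) W` says that `m` is a left null
vector of the diagonal block of the Laplacian. -/
theorem IsBalancing.leftNull {m : Fin n → ℝ} (hW : ∀ i j, 0 ≤ W i j) (hm : IsBalancing W m)
    {S : Set (Fin n)} (hS : IsLSCC W S) {j : Fin n} (hj : j ∈ S) :
    (∑ i, if i ∈ S then laplacian W i j * m i else 0) = 0 := by
  have h1 := hm.2.2 S ((isLSCC_diagonal_mul_iff hm.1).2 hS) j hj
  simp only [Matrix.diagonal_mul] at h1
  have h2 : ∀ k, (if k ∈ S then m j * W j k else 0) = m j * W j k := by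
    intro k
    split_ifs with hk
    · rfl
    · rw [le_antisymm (not_lt.1 (hS.2 j hj k hk)) (hW j k), mul_zero]
  have h3 : ∀ i, (if i ∈ S then laplacian W i j * m i else 0) =
      (if i = j then m j * ∑ k, W j k else 0) - if i ∈ S then m i * W i j else 0 := by
    intro i
    by_cases hij : i = j
    · subst hij
      simp only [hj, if_true, laplacian, Matrix.sub_apply, Matrix.diagonal_apply_eq]
      ring
    · simp only [hij, if_false, laplacian, Matrix.sub_apply, Matrix.diagonal_apply_ne _ hij]
      split_ifs <;> ring
  simp only [h2, ← Finset.mul_sum] at h1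
  simp only [h3, Finset.sum_sub_distrib, Finset.sum_ite_eq', Finset.mem_univ, if_true, h1,
    sub_self]

end LeftNull

/-! ### Averaging over the cells -/

section Cells

variable {n r : ℕ} {c : Fin n → Fin r} {d : Fin n → ℝ}

/-- The sum of `d` over the cell `k`. -/
def cellSum (c : Fin n → Fin r) (d : Fin n → ℝ) (k : Fin r) : ℝ :=
  ∑ i, if c i = k then d i else 0

theorem mul_cellSum_pos (hsign : ∀ i j, c i = c j → 0 < d i * d j) (i : Fin n) :
    0 < d i * cellSum c d (c i) := by
  rw [cellSum, Finset.mul_sum]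
  refine Finset.sum_pos' (fun j _ => ?_) ⟨i, Finset.mem_univ i, ?_⟩
  · split_ifs with h
    · exact (hsign i j h.symm).le
    · rw [mul_zero]
  · rw [if_pos rfl]
    exact hsign i i rfl

theorem cellSum_ne_zero (hc : Function.Surjective c)
    (hsign : ∀ i j, c i = c j → 0 < d i * d j) (k : Fin r) : cellSum c d k ≠ 0 := by
  obtain ⟨i, rfl⟩ := hc k
  exact right_ne_zero_of_mul (mul_cellSum_pos hsign i).ne'

theorem weight_pos (hsign : ∀ i j, c i = c j → 0 < d i * d j) (i : Fin n) :
    0 < d i / cellSum c d (c i) := by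
  have h := mul_cellSum_pos hsign i
  rcases mul_pos_iff.1 h with ⟨h1, h2⟩ | ⟨h1, h2⟩
  · exact div_pos h1 h2
  · exact div_pos_of_neg_of_neg h1 h2

theorem charMatrix_mulVec (c : Fin n → Fin r) (z : Fin r → ℝ) (i : Fin n) :
    (charMatrix c *ᵥ z) i = z (c i) := by
  simp [charMatrix, Matrix.mulVec, dotProduct]

theorem leftProj_apply (h : ∀ k, cellSum c d k ≠ 0) (k : Fin r) (i : Fin n) :
    leftProj c d k i = if c i = k then d i / cellSum c d (c i) else 0 := by
  have h1 : (charMatrix c)ᵀ * Matrix.diagonal d * charMatrix c =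
      Matrix.diagonal (cellSum c d) := by
    ext k l
    rw [Matrix.mul_apply, Matrix.diagonal_apply]
    simp only [Matrix.mul_diagonal, Matrix.transpose_apply, charMatrix, Matrix.of_apply, cellSum]
    split_ifs with hkl
    · subst hkl
      exact Finset.sum_congr rfl fun i _ => by split_ifs <;> simp
    · refine Finset.sum_eq_zero fun i _ => ?_
      by_cases hik : c i = k
      · rw [if_neg (c := c i = l) fun hil => hkl (hik.symm.trans hil), mul_zero]
      · rw [if_neg hik, zero_mul, zero_mul]
  have h2 : (Matrix.diagonal (cellSum c d))⁻¹ = Matrix.diagonal fun k => (cellSum c d k)⁻¹ := by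
    refine Matrix.inv_eq_right_inv ?_
    rw [Matrix.diagonal_mul_diagonal, ← Matrix.diagonal_one]
    exact congrArg _ (funext fun k => mul_inv_cancel₀ (h k))
  rw [leftProj, h1, h2, Matrix.mul_diagonal, Matrix.diagonal_mul, Matrix.transpose_apply,
    charMatrix, Matrix.of_apply]
  split_ifs with hik
  · rw [hik, mul_one, mul_comm, div_eq_mul_inv]
  · rw [mul_zero, zero_mul]

theorem leftProj_mulVec (h : ∀ k, cellSum c d k ≠ 0) (x : Fin n → ℝ) (k : Fin r) :
    (leftProj c d *ᵥ x) k =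
      ∑ i, if c i = k then d i / cellSum c d (c i) * x i else 0 := by
  rw [Matrix.mulVec, dotProduct]
  refine Finset.sum_congr rfl fun i _ => ?_
  rw [leftProj_apply h, ite_mul, zero_mul]

theorem sum_weight (h : ∀ k, cellSum c d k ≠ 0) (k : Fin r) :
    (∑ i, if c i = k then d i / cellSum c d (c i) else 0) = 1 := by
  have h1 : ∀ i, (if c i = k then d i / cellSum c d (c i) else 0) =
      (if c i = k then d i else 0) / cellSum c d k := by
    intro i
    split_ifs with hik
    · rw [hik]
    · rw [zero_div]
  simp only [h1, ← Finset.sum_div]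
  exact div_self (h k)

theorem leftProj_mul_charMatrix (h : ∀ k, cellSum c d k ≠ 0) :
    leftProj c d * charMatrix c = 1 := by
  refine Matrix.ext_of_mulVec_single fun l => funext fun k => ?_
  rw [← Matrix.mulVec_mulVec, leftProj_mulVec h, Matrix.one_mulVec]
  simp only [charMatrix_mulVec]
  rw [← one_mul ((Pi.single l 1 : Fin r → ℝ) k), ← sum_weight h k, Finset.sum_mul]
  refine Finset.sum_congr rfl fun i _ => ?_
  split_ifs with hik
  · rw [hik]
  · rw [zero_mul]

/-- Vectors that are constant on the cells are fixed by averaging over the cells. -/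
theorem charMatrix_mul_leftProj_mulVec (h : ∀ k, cellSum c d k ≠ 0) {x : Fin n → ℝ}
    (hx : ∀ i j, c i = c j → x i = x j) : (charMatrix c * leftProj c d) *ᵥ x = x := by
  funext i
  rw [← Matrix.mulVec_mulVec, charMatrix_mulVec, leftProj_mulVec h, ← one_mul (x i),
    ← sum_weight h (c i), Finset.sum_mul]
  refine Finset.sum_congr rfl fun j _ => ?_
  split_ifs with hji
  · rw [hx j i hji]
  · rw [zero_mul]

/-- Vectors that are proportional to `d` on each cell are fixed by the transposed averaging. -/
theorem vecMul_charMatrix_mul_leftProj (h : ∀ k, cellSum c d k ≠ 0) {η : Fin n → ℝ}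
    (hη : ∀ j, ∃ b : ℝ, ∀ i, c i = c j → η i = b * d i) :
    η ᵥ* (charMatrix c * leftProj c d) = η := by
  funext j
  obtain ⟨b, hb⟩ := hη j
  have h1 : ∀ i, (charMatrix c * leftProj c d) i j =
      if c i = c j then d j / cellSum c d (c j) else 0 := by
    intro i
    simp only [Matrix.mul_apply, charMatrix, Matrix.of_apply, leftProj_apply h, ite_mul, one_mul,
      zero_mul, Finset.sum_ite_eq, Finset.mem_univ, if_true]
    exact if_congr eq_comm rfl rfl
  have h2 : ∀ i, η i * (charMatrix c * leftProj c d) i j =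
      (if c i = c j then d i else 0) * (b * (d j / cellSum c d (c j))) := by
    intro i
    rw [h1]
    split_ifs with hij
    · rw [hb i hij]; ring
    · rw [mul_zero, zero_mul]
  rw [Matrix.vecMul, dotProduct, Finset.sum_congr rfl fun i _ => h2 i, ← Finset.sum_mul, hb j rfl]
  change cellSum c d (c j) * _ = _
  have := h (c j)
  field_simp

/-- The reduced Laplacian is again the Laplacian of a digraph with nonnegative weights. -/
theorem IsLaplacian.reduced {L : Matrix (Fin n) (Fin n) ℝ} (hL : IsLaplacian L)
    (h : ∀ k, cellSum c d k ≠ 0) (hsign : ∀ i j, c i = c j → 0 < d i * d j) :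
    IsLaplacian (leftProj c d * L * charMatrix c) where
  offDiag_nonpos k l hkl := by
    rw [Matrix.mul_apply]
    refine Finset.sum_nonpos fun j _ => ?_
    rw [Matrix.mul_apply, Finset.sum_mul]
    refine Finset.sum_nonpos fun i _ => ?_
    rw [leftProj_apply h, charMatrix, Matrix.of_apply]
    split_ifs with hik hjl
    · have hij : i ≠ j := fun hij => hkl (by rw [← hik, ← hjl, hij])
      rw [mul_one]
      exact mul_nonpos_of_nonneg_of_nonpos (weight_pos hsign i).le (hL.offDiag_nonpos i j hij)
    all_goals simp
  row_sum k := by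
    have h1 : L *ᵥ 1 = 0 := by
      funext i
      simpa [Matrix.mulVec, dotProduct] using hL.row_sum i
    have h2 : charMatrix c *ᵥ 1 = 1 := funext fun i => charMatrix_mulVec c 1 i
    have h3 : (leftProj c d * L * charMatrix c) *ᵥ 1 = 0 := by
      rw [← Matrix.mulVec_mulVec, h2, ← Matrix.mulVec_mulVec, h1, Matrix.mulVec_zero]
    simpa [Matrix.mulVec, dotProduct] using congrFun h3 k

/-- If the cell averages of `L Π z` vanish, so does `L Π z` at every maximum point of `Π z`: the
whole cell of such a point consists of maximum points, where `L Π z` is nonnegative. -/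
theorem mulVec_eq_zero_at_max {L : Matrix (Fin n) (Fin n) ℝ} (hL : IsLaplacian L)
    (h : ∀ k, cellSum c d k ≠ 0) (hsign : ∀ i j, c i = c j → 0 < d i * d j) {z : Fin r → ℝ}
    (hz : leftProj c d *ᵥ (L *ᵥ (charMatrix c *ᵥ z)) = 0) {i : Fin n}
    (hi : ∀ k, (charMatrix c *ᵥ z) k ≤ (charMatrix c *ᵥ z) i) :
    (L *ᵥ (charMatrix c *ᵥ z)) i = 0 := by
  have h1 := congrFun hz (c i)
  rw [leftProj_mulVec h, Pi.zero_apply, Finset.sum_eq_zero_iff_of_nonneg] at h1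
  · have h2 := h1 i (Finset.mem_univ i)
    rw [if_pos rfl] at h2
    exact (mul_eq_zero.1 h2).resolve_left (weight_pos hsign i).ne'
  · intro j _
    split_ifs with hji
    · refine mul_nonneg (weight_pos hsign j).le (hL.mulVec_nonneg_of_max fun k => ?_)
      rw [charMatrix_mulVec c z j, hji, ← charMatrix_mulVec c z i]
      exact hi k
    · exact le_rfl

/-- If averaging over the cells fixes the projection `J` from both sides, the reduced projection
is the projection onto the kernel of the reduced Laplacian. By the maximum principle the reduced
Laplacian has no kernel besides the range of the reduced projection. -/
theorem IsKernelProj.reduced {L J : Matrix (Fin n) (Fin n) ℝ} (hL : IsLaplacian L)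
    (hJ : IsKernelProj L J) (h : ∀ k, cellSum c d k ≠ 0)
    (hsign : ∀ i j, c i = c j → 0 < d i * d j)
    (hPJ : charMatrix c * leftProj c d * J = J) (hJP : J * (charMatrix c * leftProj c d) = J) :
    IsKernelProj (leftProj c d * L * charMatrix c) (leftProj c d * J * charMatrix c) := by
  have hred := hL.reduced h hsign
  set R := charMatrix c with hR
  set S := leftProj c d with hS
  obtain ⟨J', hJ'⟩ := hred.exists_isKernelProj
  have hleft : S * L * R * (S * J * R) = 0 := by
    have : S * L * R * (S * J * R) = S * L * (R * S * J) * R := by simp only [Matrix.mul_assoc]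
    rw [this, hPJ, Matrix.mul_assoc S, hJ.mul_proj, Matrix.mul_zero, Matrix.zero_mul]
  have hright : S * J * R * (S * L * R) = 0 := by
    have : S * J * R * (S * L * R) = S * (J * (R * S)) * L * R := by simp only [Matrix.mul_assoc]
    rw [this, hJP, Matrix.mul_assoc S, hJ.proj_mul, Matrix.mul_zero, Matrix.zero_mul]
  have hidem : S * J * R * (S * J * R) = S * J * R := by
    have : S * J * R * (S * J * R) = S * (J * (R * S)) * J * R := by simp only [Matrix.mul_assoc]
    rw [this, hJP, Matrix.mul_assoc S, hJ.proj_mul_self]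
  have hker : ∀ z, (S * L * R) *ᵥ z = 0 → (S * J * R) *ᵥ z = 0 → z = 0 := by
    intro z hz hz'
    have hJz : J *ᵥ (R *ᵥ z) = 0 := by
      have h1 := congrArg (fun y => R *ᵥ y) hz'
      have h2 : R * (S * J * R) = J * R := by
        rw [← Matrix.mul_assoc, ← Matrix.mul_assoc, hPJ]
      simpa only [Matrix.mulVec_mulVec, Matrix.mulVec_zero, h2] using h1
    obtain ⟨u, hu⟩ := hJ.exists_mulVec_eq hJz
    have hz2 : S *ᵥ (L *ᵥ (R *ᵥ z)) = 0 := by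
      simpa only [Matrix.mulVec_mulVec, Matrix.mul_assoc] using hz
    have hRz : R *ᵥ z = 0 := by
      refine hL.eq_zero_of_harmonic_at_extrema hu
        (fun i hi => mulVec_eq_zero_at_max hL h hsign hz2 hi) fun i hi => ?_
      have h3 := mulVec_eq_zero_at_max (c := c) (d := d) (z := -z) hL h hsign
        (by rw [Matrix.mulVec_neg, Matrix.mulVec_neg, Matrix.mulVec_neg, ← hS, hz2, neg_zero])
        (i := i) (fun k => by
          rw [Matrix.mulVec_neg, Pi.neg_apply, Pi.neg_apply]
          exact neg_le_neg (hi k))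
      rw [Matrix.mulVec_neg, Matrix.mulVec_neg, Pi.neg_apply] at h3
      exact neg_eq_zero.1 h3
    rw [← Matrix.one_mulVec z, ← leftProj_mul_charMatrix h, ← Matrix.mulVec_mulVec, ← hR, hRz,
      Matrix.mulVec_zero]
  -- `S J R` fixes the kernel of the reduced Laplacian and annihilates its range, as `J'` does
  have hfix : S * J * R * J' = J' := by
    refine Matrix.ext_of_mulVec_single fun l => ?_
    rw [← sub_eq_zero, ← Matrix.sub_mulVec]
    refine hker _ ?_ ?_
    · rw [Matrix.mulVec_mulVec, Matrix.mul_sub, ← Matrix.mul_assoc, hleft, hJ'.mul_proj,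
        Matrix.zero_mul, sub_zero, Matrix.zero_mulVec]
    · rw [Matrix.mulVec_mulVec, Matrix.mul_sub, ← Matrix.mul_assoc, hidem, sub_self,
        Matrix.zero_mulVec]
  have heq : S * J * R = J' := by
    obtain ⟨Y, hY⟩ := hJ'.exists_mul_left
    have h1 : S * J * R * (1 - J') = 0 := by
      rw [hY, ← Matrix.mul_assoc, hright, Matrix.zero_mul]
    rw [Matrix.mul_sub, Matrix.mul_one, hfix, sub_eq_zero] at h1
    exact h1
  rw [heq]
  exact hJ'

end Cells

/-! ### Clusterable vertices and the steady-state projection -/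

section Clustering

variable {n r : ℕ} {W J : Matrix (Fin n) (Fin n) ℝ} {m : Fin n → ℝ} {c : Fin n → Fin r}
  {d : Fin n → ℝ}

theorem Clusterable.eq_of_mulVec_eq_zero {i j : Fin n} (h : Clusterable W m i j)
    {x : Fin n → ℝ} (hx : laplacian W *ᵥ x = 0) : x i = x j := by
  have h1 := h.1 x (by rw [← Matrix.mulVec_mulVec, hx, Matrix.mulVec_zero])
  rw [sub_dotProduct, single_one_dotProduct, single_one_dotProduct] at h1
  exact sub_eq_zero.1 h1

theorem Clusterable.eq_of_vecMul_eq_zero {i j : Fin n} (h : Clusterable W m i j)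
    {y : Fin n → ℝ} (hy : (fun i => m i * y i) ᵥ* laplacian W = 0) : y i = y j := by
  have h1 := h.2 y (by
    have h2 : Matrix.diagonal m *ᵥ y = fun i => m i * y i :=
      funext fun i => Matrix.mulVec_diagonal m y i
    rw [Matrix.transpose_mul, Matrix.diagonal_transpose, ← Matrix.mulVec_mulVec, h2,
      Matrix.mulVec_transpose, hy])
  rw [sub_dotProduct, single_one_dotProduct, single_one_dotProduct] at h1
  exact sub_eq_zero.1 h1

theorem charMatrix_mul_leftProj_mul_proj (hJ : IsKernelProj (laplacian W) J)
    (hproper : ProperClustering W m c) (h : ∀ k, cellSum c d k ≠ 0) :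
    charMatrix c * leftProj c d * J = J := by
  refine Matrix.ext_of_mulVec_single fun l => ?_
  rw [← Matrix.mulVec_mulVec]
  refine charMatrix_mul_leftProj_mulVec h fun i j hij =>
    (hproper i j hij).eq_of_mulVec_eq_zero ?_
  rw [Matrix.mulVec_mulVec, hJ.mul_proj, Matrix.zero_mulVec]

/-- A left null vector `η` of the Laplacian is proportional to `d` on each cell: `η / m` is
constant on the cell, and if it is nonzero there, the cell lies in a single leading strongly
connected component, on which `m` and `d` are both multiples of the positive left null vector. -/
theorem exists_eq_mul_of_vecMul_eq_zero (hW : ∀ i j, 0 ≤ W i j) (hm : IsBalancing W m)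
    (hproper : ProperClustering W m c) (hd : Admissible W c d)
    (hsign : ∀ i j, c i = c j → 0 < d i * d j) {η : Fin n → ℝ}
    (hη : η ᵥ* laplacian W = 0) (j : Fin n) : ∃ b : ℝ, ∀ i, c i = c j → η i = b * d i := by
  classical
  have hratio : ∀ i, c i = c j → η i / m i = η j / m j := by
    intro i hij
    refine (hproper i j hij).eq_of_vecMul_eq_zero (y := fun i => η i / m i) ?_
    rw [← hη]
    congr 1
    exact funext fun i => mul_div_cancel₀ _ (hm.1 i).ne'
  have hη' : ∀ i, c i = c j → η i = η j / m j * m i := fun i hij => by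
    rw [← hratio i hij, div_mul_cancel₀ _ (hm.1 i).ne']
  by_cases hj : η j = 0
  · exact ⟨0, fun i hij => by rw [hη' i hij, hj, zero_div, zero_mul, zero_mul]⟩
  have hS := isLSCC_scc_of_vecMul_eq_zero hW hη hj
  set S := scc W j with hSdef
  have hjS : j ∈ S := ⟨Relation.ReflTransGen.refl, Relation.ReflTransGen.refl⟩
  have hmS := fun k hk => hm.leftNull hW hS (j := k) hk
  -- `1_S` is a left null vector of `diag(m) ℒ`, hence constant on the cells
  have hcell : ∀ i, c i = c j → i ∈ S := by
    intro i hij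
    have h1 := (hproper i j hij).eq_of_vecMul_eq_zero (y := fun i => if i ∈ S then 1 else 0) (by
      simpa only [mul_ite, mul_one, mul_zero] using vecMul_extend_eq_zero hW hS hmS)
    by_contra hi
    simp [hi, hjS] at h1
  obtain ⟨ν, hν0, hν, a, ha⟩ := hd.2 S hS
  obtain ⟨ρ, hρ⟩ := exists_eq_mul_of_leftNull hW hS hν0 hmS hν
  -- `d` vanishes nowhere, since `d j * d j` is positive
  have ha0 : a ≠ 0 := by
    rintro rfl
    have h1 := hsign j j rfl
    rw [ha j hjS, zero_mul, zero_mul] at h1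
    exact lt_irrefl _ h1
  refine ⟨η j / m j * ρ / a, fun i hij => ?_⟩
  rw [hη' i hij, hρ i (hcell i hij), ha i (hcell i hij)]
  field_simp

theorem proj_mul_charMatrix_mul_leftProj (hJ : IsKernelProj (laplacian W) J)
    (hW : ∀ i j, 0 ≤ W i j) (hm : IsBalancing W m)
    (hproper : ProperClustering W m c) (hd : Admissible W c d)
    (hsign : ∀ i j, c i = c j → 0 < d i * d j) (h : ∀ k, cellSum c d k ≠ 0) :
    J * (charMatrix c * leftProj c d) = J := by
  funext i
  have hrow : (J i) ᵥ* laplacian W = 0 := by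
    funext j
    exact congrFun (congrFun hJ.proj_mul i) j
  exact vecMul_charMatrix_mul_leftProj h
    (exists_eq_mul_of_vecMul_eq_zero hW hm hproper hd hsign hrow)

end Clustering

end NetRed

end

theorem mainTheorem6 {n r p q : ℕ}
    (W : Matrix (Fin n) (Fin n) ℝ) (hW : ∀ i j, 0 ≤ W i j) (hconn : NetRed.WeaklyConnected W)
    (F : Matrix (Fin n) (Fin p) ℝ) (H : Matrix (Fin q) (Fin n) ℝ)
    (m : Fin n → ℝ) (hm : NetRed.IsBalancing W m)
    (c : Fin n → Fin r) (hc : Function.Surjective c) (hproper : NetRed.ProperClustering W m c)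
    (d : Fin n → ℝ) (hd : NetRed.Admissible W c d)
    (hsign : ∀ i j, c i = c j → 0 < d i * d j) :
    NetRed.Semistable (-NetRed.laplacian W) ∧
    NetRed.Semistable (-NetRed.reducedLaplacian W c d) ∧
    NetRed.GramianWellDefined (-NetRed.laplacian W) F ∧
    NetRed.GramianWellDefined (-NetRed.reducedLaplacian W c d) (NetRed.leftProj c d * F) ∧
    NetRed.reductionError W F H c d ≠ ⊤ ∧
    (∃ X : Matrix (Fin r) (Fin n) ℝ, NetRed.SolvesSylvester W F c d X) ∧
    ∀ X : Matrix (Fin r) (Fin n) ℝ, NetRed.SolvesSylvester W F c d X →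
      (NetRed.reductionError W F H c d).toReal ^ 2 =
        (H * (NetRed.pseudoControllabilityGramian (-NetRed.laplacian W) F +
          NetRed.charMatrix c *
            NetRed.pseudoControllabilityGramian (-NetRed.reducedLaplacian W c d)
              (NetRed.leftProj c d * F) * (NetRed.charMatrix c)ᵀ -
          (2 : ℝ) • (NetRed.charMatrix c * NetRed.crossGramian W c d X)) * Hᵀ).trace := by
  have hL := NetRed.isLaplacian_laplacian hW
  obtain ⟨J, hJ⟩ := hL.exists_isKernelProj
  have h := NetRed.cellSum_ne_zero hc hsign
  have hPJ := NetRed.charMatrix_mul_leftProj_mul_proj (d := d) hJ hproper h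
  have hJP := NetRed.proj_mul_charMatrix_mul_leftProj hJ hW hm hproper hd hsign h
  have hL' : NetRed.IsLaplacian (NetRed.reducedLaplacian W c d) := hL.reduced h hsign
  have hJ' : NetRed.IsKernelProj (NetRed.reducedLaplacian W c d)
      (NetRed.leftProj c d * J * NetRed.charMatrix c) :=
    NetRed.IsKernelProj.reduced hL hJ h hsign hPJ hJP
  have hSJ : NetRed.leftProj c d * J * NetRed.charMatrix c * NetRed.leftProj c d =
      NetRed.leftProj c d * J := by
    rw [Matrix.mul_assoc, Matrix.mul_assoc, hJP]
  have hRS : NetRed.charMatrix c * (NetRed.leftProj c d * J * NetRed.charMatrix c) *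
      NetRed.leftProj c d = J := by
    rw [Matrix.mul_assoc, hSJ, ← Matrix.mul_assoc, hPJ]
  obtain ⟨hfin, hval⟩ := NetRed.h2Norm_impulseResponse_sub hL hJ hL' hJ' hRS F H
  obtain ⟨hcross, hex⟩ := NetRed.entryIntegral_cross hL hJ hL' hJ' hSJ F
  simp only [NetRed.SolvesSylvester, NetRed.crossGramian, hL.limExp_neg hJ]
  exact ⟨NetRed.semistable_of_tendsto (hL.tendsto_exp hJ),
    NetRed.semistable_of_tendsto (hL'.tendsto_exp hJ'), hL.gramianWellDefined hJ F,
    hL'.gramianWellDefined hJ' _, hfin, hex, fun X hX => by rw [← hcross X hX]; exact hval⟩
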